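/- Let $\epsilon\in\{1,-1\}$ and let $(M,g)$ be a connected (Hausdorff, smooth) pseudo-Riemannian manifold of dimension $\dim M\ge 4$ with Levi-Civita connection $\nabla$. Let $J$ be a smooth section of $\mathfrak{so}(TM)$ (that is, $g(JX,Y)+g(X,JY)=0$) with $J^2=\epsilon$ and $\nabla J=0$, so that $(M,g,J)$ is an $\epsilon$-Kähler manifold. Let $R_{XY}Z=\nabla_{[X,Y]}Z-[\nabla_X,\nabla_Y]Z$ be the curvature, $r(U,V)=\operatorname{tr}(X\mapsto R_{UX}V)$ the Ricci tensor, and the scalar curvature the $g$-trace of $r$. Let $S$ be a smooth tensor field of type $(1,2)$ which is a homogeneous $\epsilon$-Kähler structure, i.e. for $\tilde\nabla=\nabla-S$ one has $$\tilde\nabla g=0,\qquad \tilde\nabla R=0,\qquad \tilde\nabla S=0,\qquad \tilde\nabla J=0,$$ and suppose that $S$ is of linear type, given by smooth vector fields $\xi$ and $\zeta$: $$S_XY=g(X,Y)\xi-g(\xi,Y)X+\epsilon\, g(X,JY)J\xi-\epsilon\, g(\xi,JY)JX-2g(\zeta,JX)JY .$$ Suppose that $S$ is degenerate, i.e. $\xi$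 is a null vector field: $g(\xi,\xi)=0$ everywhere and $\xi$ does not vanish identically. Then there is a constant $\lambda\in\mathbb{R}$ such that $\zeta=\lambda\xi$ on $M$ and $$r=-\frac1a\,\lambda(\epsilon+2\lambda)\bigl(\theta\otimes\theta-\epsilon(\theta\circ J)\otimes(\theta\circ J)\bigr),\qquad \theta=g(\xi,\cdot),\quad a=\frac{1}{\dim M+2},$$ and the scalar curvature of $(M,g)$ vanishes identically. -/

import Mathlib

open Bundle Module
open scoped Manifold ContDiff

noncomputable section

namespace EpsKahler

variable {E : Type*} [NormedAddCommGroup E] [NormedSpace ℝ E]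
  {M : Type*} [TopologicalSpace M] [ChartedSpace E M]

/-- Vector fields on `M` (not necessarily continuous). -/
abbrev VField (E : Type*) [NormedAddCommGroup E] [NormedSpace ℝ E]
    (M : Type*) [TopologicalSpace M] [ChartedSpace E M] :=
  ∀ p : M, TangentSpace 𝓘(ℝ, E) p

/-- `X` is a smooth vector field. -/
def SmoothField [IsManifold 𝓘(ℝ, E) ∞ M] (X : VField E M) : Prop :=
  ContMDiff 𝓘(ℝ, E) (𝓘(ℝ, E).prod 𝓘(ℝ, E)) ∞
    (fun p ↦ TotalSpace.mk' E (E := fun q : M ↦ TangentSpace 𝓘(ℝ, E) q) p (X p))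

/-- Pseudo-Riemannian metrics: smooth fields of nondegenerate symmetric bilinear forms,
of arbitrary signature. -/
structure PseudoRiemannianMetric (E : Type*) [NormedAddCommGroup E] [NormedSpace ℝ E]
    (M : Type*) [TopologicalSpace M] [ChartedSpace E M] [IsManifold 𝓘(ℝ, E) ∞ M] where
  /-- The bilinear form on the tangent space at `p`. -/
  val : ∀ p : M, TangentSpace 𝓘(ℝ, E) p →L[ℝ] TangentSpace 𝓘(ℝ, E) p →L[ℝ] ℝ
  symm : ∀ (p : M) (v w : TangentSpace 𝓘(ℝ, E) p), val p v w = val p w v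
  nondegenerate : ∀ (p : M) (v : TangentSpace 𝓘(ℝ, E) p), (∀ w, val p v w = 0) → v = 0
  smooth : ContMDiff 𝓘(ℝ, E) (𝓘(ℝ, E).prod 𝓘(ℝ, E →L[ℝ] E →L[ℝ] ℝ)) ∞
    (fun p ↦ TotalSpace.mk' (E →L[ℝ] E →L[ℝ] ℝ)
      (E := fun q : M ↦ TangentSpace 𝓘(ℝ, E) q →L[ℝ] TangentSpace 𝓘(ℝ, E) q →L[ℝ] ℝ) p (val p))

/-- A smooth tensor field of type `(1, 1)`, i.e. a smooth section of `End(TM)`. -/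
def SmoothEndo [IsManifold 𝓘(ℝ, E) ∞ M]
    (J : ∀ p : M, TangentSpace 𝓘(ℝ, E) p →L[ℝ] TangentSpace 𝓘(ℝ, E) p) : Prop :=
  ContMDiff 𝓘(ℝ, E) (𝓘(ℝ, E).prod 𝓘(ℝ, E →L[ℝ] E)) ∞
    (fun p ↦ TotalSpace.mk' (E →L[ℝ] E)
      (E := fun q : M ↦ TangentSpace 𝓘(ℝ, E) q →L[ℝ] TangentSpace 𝓘(ℝ, E) q) p (J p))

/-- A smooth tensor field of type `(1, 2)`; `S p x y` stands for `S_x y`. -/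
def SmoothTensor12 [IsManifold 𝓘(ℝ, E) ∞ M]
    (S : ∀ p : M, TangentSpace 𝓘(ℝ, E) p →L[ℝ]
      TangentSpace 𝓘(ℝ, E) p →L[ℝ] TangentSpace 𝓘(ℝ, E) p) : Prop :=
  ContMDiff 𝓘(ℝ, E) (𝓘(ℝ, E).prod 𝓘(ℝ, E →L[ℝ] E →L[ℝ] E)) ∞
    (fun p ↦ TotalSpace.mk' (E →L[ℝ] E →L[ℝ] E)
      (E := fun q : M ↦ TangentSpace 𝓘(ℝ, E) q →L[ℝ]
        TangentSpace 𝓘(ℝ, E) q →L[ℝ] TangentSpace 𝓘(ℝ, E) q) p (S p))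

/-- Linear connections on `M`, i.e. covariant derivatives on the tangent bundle. -/
abbrev Connection (E : Type*) [NormedAddCommGroup E] [NormedSpace ℝ E]
    (M : Type*) [TopologicalSpace M] [ChartedSpace E M] [IsManifold 𝓘(ℝ, E) ∞ M] :=
  CovariantDerivative 𝓘(ℝ, E) E (TangentSpace 𝓘(ℝ, E) : M → Type _)

section Connections

variable [IsManifold 𝓘(ℝ, E) ∞ M]

/-- The vector field `∇_X Y`. -/
def along (D : Connection E M) (X Y : VField E M) : VField E M :=
  fun p ↦ D Y p (X p)

/-- `∇ g = 0`: `X (g(Y, Z)) = g(∇_X Y, Z) + g(Y, ∇_X Z)` for all smooth vector fields. -/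
def ParallelMetric (D : Connection E M) (g : PseudoRiemannianMetric E M) : Prop :=
  ∀ X Y Z : VField E M, SmoothField X → SmoothField Y → SmoothField Z → ∀ p : M,
    mfderiv 𝓘(ℝ, E) 𝓘(ℝ, ℝ) (fun q ↦ g.val q (Y q) (Z q)) p (X p) =
      g.val p (along D X Y p) (Z p) + g.val p (Y p) (along D X Z p)

/-- `∇ J = 0` for a tensor field `J` of type `(1, 1)`. -/
def ParallelEndo (D : Connection E M)
    (J : ∀ p : M, TangentSpace 𝓘(ℝ, E) p →L[ℝ] TangentSpace 𝓘(ℝ, E) p) : Prop :=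
  ∀ X Y : VField E M, SmoothField X → SmoothField Y → ∀ p : M,
    along D X (fun q ↦ J q (Y q)) p = J p (along D X Y p)

/-- `∇ S = 0` for a tensor field `S` of type `(1, 2)`. -/
def ParallelTensor12 (D : Connection E M)
    (S : ∀ p : M, TangentSpace 𝓘(ℝ, E) p →L[ℝ]
      TangentSpace 𝓘(ℝ, E) p →L[ℝ] TangentSpace 𝓘(ℝ, E) p) : Prop :=
  ∀ X Y Z : VField E M, SmoothField X → SmoothField Y → SmoothField Z → ∀ p : M,
    along D X (fun q ↦ S q (Y q) (Z q)) p =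
      S p (along D X Y p) (Z p) + S p (Y p) (along D X Z p)

/-- The curvature `R_{XY} Z = ∇_{[X, Y]} Z - (∇_X ∇_Y Z - ∇_Y ∇_X Z)`. -/
def curvature (D : Connection E M) (X Y Z : VField E M) : VField E M :=
  fun p ↦ along D (VectorField.mlieBracket 𝓘(ℝ, E) X Y) Z p
    - (along D X (along D Y Z) p - along D Y (along D X Z) p)

/-- `D R = 0`, where `R` is the curvature of the connection `D₀`. -/
def ParallelCurvature (D D₀ : Connection E M) : Prop :=
  ∀ X Y Z W : VField E M, SmoothField X → SmoothField Y → SmoothField Z → SmoothField W →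
    ∀ p : M, along D X (curvature D₀ Y Z W) p =
      curvature D₀ (along D X Y) Z W p + curvature D₀ Y (along D X Z) W p
        + curvature D₀ Y Z (along D X W) p

/-- `D` is the Levi-Civita connection of `g`: the smooth connection that is torsion-free and
satisfies `D g = 0`. -/
structure IsLeviCivita (g : PseudoRiemannianMetric E M) (D : Connection E M) : Prop where
  smooth : D.ContMDiffCovariantDerivative ∞
  torsion_free : ∀ X Y : VField E M, SmoothField X → SmoothField Y → ∀ p : M,
    along D X Y p - along D Y X p = VectorField.mlieBracket 𝓘(ℝ, E) X Y p
  metric : ParallelMetric D g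

/-- The curvature tensor at a point: `R_{uv} w` for tangent vectors `u`, `v`, `w` at `p`, computed
with vector fields that are smooth near `p` and extend the three vectors. -/
def curvatureAt (D : Connection E M) (p : M) (u v w : TangentSpace 𝓘(ℝ, E) p) :
    TangentSpace 𝓘(ℝ, E) p :=
  curvature D (FiberBundle.extend E u) (FiberBundle.extend E v) (FiberBundle.extend E w) p

/-- A basis of the tangent space at `p`, used to compute traces. -/
def tangentBasis [FiniteDimensional ℝ E] (p : M) :
    Basis (Fin (finrank ℝ E)) ℝ (TangentSpace 𝓘(ℝ, E) p) :=
  (finBasis ℝ E : Basis (Fin (finrank ℝ E)) ℝ E)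

/-- The Ricci tensor `r(u, v) = tr (x ↦ R_{ux} v)`. -/
def ricci [FiniteDimensional ℝ E] (D : Connection E M) (p : M)
    (u v : TangentSpace 𝓘(ℝ, E) p) : ℝ :=
  ∑ i, (tangentBasis p).repr (curvatureAt D p u (tangentBasis p i) v) i

/-- The Gram matrix of `g` in the basis `tangentBasis p`; it is invertible. -/
def gramMatrix [FiniteDimensional ℝ E] (g : PseudoRiemannianMetric E M) (p : M) :
    Matrix (Fin (finrank ℝ E)) (Fin (finrank ℝ E)) ℝ :=
  Matrix.of fun i j ↦ g.val p (tangentBasis p i) (tangentBasis p j)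

/-- The scalar curvature `∑ g^{ij} r_{ij}`. -/
def scalarCurvature [FiniteDimensional ℝ E] (g : PseudoRiemannianMetric E M)
    (D : Connection E M) (p : M) : ℝ :=
  ∑ i, ∑ j, (gramMatrix g p)⁻¹ i j * ricci D p (tangentBasis p i) (tangentBasis p j)

/-- `(M, g, J)` is `ε`-Kähler, `D` being the Levi-Civita connection of `g`: `J` is a smooth
`g`-skew-symmetric endomorphism field with `J² = ε` and `D J = 0`. -/
structure IsEpsKahler (ε : ℝ) (g : PseudoRiemannianMetric E M) (D : Connection E M)
    (J : ∀ p : M, TangentSpace 𝓘(ℝ, E) p →L[ℝ] TangentSpace 𝓘(ℝ, E) p) : Prop where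
  smooth : SmoothEndo J
  skew : ∀ (p : M) (v w : TangentSpace 𝓘(ℝ, E) p), g.val p (J p v) w + g.val p v (J p w) = 0
  sq : ∀ (p : M) (v : TangentSpace 𝓘(ℝ, E) p), J p (J p v) = ε • v
  parallel : ParallelEndo D J

/-- The connection `D - S`, i.e. `(X, Y) ↦ D_X Y - S_X Y`. -/
def subTensor (D : Connection E M)
    (S : ∀ p : M, TangentSpace 𝓘(ℝ, E) p →L[ℝ]
      TangentSpace 𝓘(ℝ, E) p →L[ℝ] TangentSpace 𝓘(ℝ, E) p) : Connection E M :=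
  D.addOneForm (fun p ↦ -(show E →L[ℝ] E →L[ℝ] E from S p).flip)

theorem along_subTensor (D : Connection E M)
    (S : ∀ p : M, TangentSpace 𝓘(ℝ, E) p →L[ℝ]
      TangentSpace 𝓘(ℝ, E) p →L[ℝ] TangentSpace 𝓘(ℝ, E) p) (X Y : VField E M) (p : M) :
    along (subTensor D S) X Y p = along D X Y p - S p (X p) (Y p) :=
  (sub_eq_add_neg _ _).symm

/-- `S` is a homogeneous `ε`-Kähler structure on `(M, g, J)`, `D` being the Levi-Civita connection
of `g`: the tensors `g`, `R`, `S`, `J` are parallel for the connection `D - S`. -/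
structure IsHomogeneousStructure (g : PseudoRiemannianMetric E M) (D : Connection E M)
    (J : ∀ p : M, TangentSpace 𝓘(ℝ, E) p →L[ℝ] TangentSpace 𝓘(ℝ, E) p)
    (S : ∀ p : M, TangentSpace 𝓘(ℝ, E) p →L[ℝ]
      TangentSpace 𝓘(ℝ, E) p →L[ℝ] TangentSpace 𝓘(ℝ, E) p) : Prop where
  smooth : SmoothTensor12 S
  parallel_metric : ParallelMetric (subTensor D S) g
  parallel_curvature : ParallelCurvature (subTensor D S) D
  parallel_self : ParallelTensor12 (subTensor D S) S
  parallel_endo : ParallelEndo (subTensor D S) J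

/-- `S` is of linear type, given by the vector fields `ξ` and `ζ`. -/
def IsLinearType (ε : ℝ) (g : PseudoRiemannianMetric E M)
    (J : ∀ p : M, TangentSpace 𝓘(ℝ, E) p →L[ℝ] TangentSpace 𝓘(ℝ, E) p)
    (S : ∀ p : M, TangentSpace 𝓘(ℝ, E) p →L[ℝ]
      TangentSpace 𝓘(ℝ, E) p →L[ℝ] TangentSpace 𝓘(ℝ, E) p) (ξ ζ : VField E M) : Prop :=
  ∀ (p : M) (x y : TangentSpace 𝓘(ℝ, E) p),
    S p x y = g.val p x y • ξ p - g.val p (ξ p) y • x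
      + (ε * g.val p x (J p y)) • J p (ξ p) - (ε * g.val p (ξ p) (J p y)) • J p x
      - (2 * g.val p (ζ p) (J p x)) • J p y

/-- The linear-type structure given by `ξ` and `ζ` is degenerate: `ξ` is a null vector field, i.e.
`ξ ≠ 0` and `g(ξ, ξ) = 0`. -/
def IsDegenerate (g : PseudoRiemannianMetric E M) (ξ : VField E M) : Prop :=
  ξ ≠ 0 ∧ ∀ p : M, g.val p (ξ p) (ξ p) = 0

end Connections

end EpsKahler

end

open EpsKahler

/-! Write `∇̃ = ∇ - S`. The proof turns the differential hypotheses into algebra at one point and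
uses parallelism to pass between points.

Parallelism. As `g`, `J` and `S` are `∇̃`-parallel, differentiating the formula for `S` shows that
the linear-type tensor built from `∇̃_X ξ` and `∇̃_X ζ` vanishes. In dimension at least four such a
tensor determines its two vectors (`eq_zero_of_linearTypeTensor_eq_zero`), so `ξ` and `ζ` are
`∇̃`-parallel. On a connected manifold a parallel field with one zero is zero
(`eq_zero_of_parallelField`). Hence `ξ` vanishes nowhere, and `ζ = λξ` holds everywhere with the
same `λ` once it holds at one point.

Algebra. The curvature of `∇̃` differs from `R` by an expression in `S` alone and annihilates `ξ`
and `ζ`, so `R_{xy} ξ` is explicit (`curvature_xi`). As `∇̃R = 0`, the derivative `∇_x R` is the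
action of `S_x` on `R`, and the second Bianchi identity becomes algebraic (`cyclic_identity`). Its
trace (`contracted_identity`) expresses `(dim M + 2) g(R_{yz} w, ξ)` through the Ricci form, which
is where `1/a` comes from. Comparing it with `curvature_xi`, together with the `J`-invariance of `R`
and `r`, determines `ζ` and `r`.

There are two cases. If some `e` has `g(ξ, e) = 1` and `g(ξ, Je) = 0`, the comparison suffices.
Otherwise `ε = 1` and `Jξ = ±ξ`; the claimed Ricci form is then zero. A possible component `η` of
`ζ` off the line of `ξ` is excluded by two further facts: the curvature of `∇̃` annihilates `ζ`, and
it acts on `R` as a derivation with result zero.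

The scalar curvature is a multiple of `g(ξ, ξ) - ε g(Jξ, Jξ)`, which is zero for null `ξ`. -/

namespace EpsKahler

/-! ### Algebra at a point: symmetries of the curvature and the second Bianchi identity -/

section PointwiseAlgebra

variable {V : Type*} [AddCommGroup V] [Module ℝ V]

/-- The linear-type tensor `S_x y` determined by the vectors `ξ` and `ζ`. -/
def linearTypeTensor (ε : ℝ) (g : V →ₗ[ℝ] V →ₗ[ℝ] ℝ) (J : V →ₗ[ℝ] V) (ξ ζ x y : V) : V :=
  g x y • ξ - g ξ y • x + (ε * g x (J y)) • J ξ - (ε * g ξ (J y)) • J x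
    - (2 * g ζ (J x)) • J y

/-- The tensor `S_{S_x y - S_y x} - [S_x, S_y]` built from the linear-type tensor; subtracted from
the curvature of the Levi-Civita connection it gives the curvature of the reduced connection. -/
def reductionCurvature (ε : ℝ) (g : V →ₗ[ℝ] V →ₗ[ℝ] ℝ) (J : V →ₗ[ℝ] V) (ξ ζ x y w : V) : V :=
  linearTypeTensor ε g J ξ ζ
      (linearTypeTensor ε g J ξ ζ x y - linearTypeTensor ε g J ξ ζ y x) w
    - (linearTypeTensor ε g J ξ ζ x (linearTypeTensor ε g J ξ ζ y w)
      - linearTypeTensor ε g J ξ ζ y (linearTypeTensor ε g J ξ ζ x w))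

/-- The infinitesimal action of `S_x` on the curvature tensor. -/
def curvatureAction (ε : ℝ) (g : V →ₗ[ℝ] V →ₗ[ℝ] ℝ) (J : V →ₗ[ℝ] V) (ξ ζ : V)
    (R : V →ₗ[ℝ] V →ₗ[ℝ] V →ₗ[ℝ] V) (x y z w : V) : V :=
  linearTypeTensor ε g J ξ ζ x (R y z w) - R (linearTypeTensor ε g J ξ ζ x y) z w
    - R y (linearTypeTensor ε g J ξ ζ x z) w - R y z (linearTypeTensor ε g J ξ ζ x w)

/-- A skew-symmetric structure `J` with `J² = ε` on a space with a nondegenerate form. -/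
structure IsHermitianForm (ε : ℝ) (g : V →ₗ[ℝ] V →ₗ[ℝ] ℝ) (J : V →ₗ[ℝ] V) : Prop where
  eps : ε = 1 ∨ ε = -1
  symm : ∀ x y, g x y = g y x
  nondegenerate : ∀ x, (∀ y, g x y = 0) → x = 0
  skew : ∀ x y, g (J x) y = -g x (J y)
  sq : ∀ x, J (J x) = ε • x

/-- The algebraic identities satisfied at a point by the curvature of an `ε`-Kähler manifold with
a degenerate homogeneous structure of linear type. -/
structure IsInfinitesimalModel (ε : ℝ) (g : V →ₗ[ℝ] V →ₗ[ℝ] ℝ) (J : V →ₗ[ℝ] V) (ξ ζ : V)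
    (R : V →ₗ[ℝ] V →ₗ[ℝ] V →ₗ[ℝ] V) : Prop extends IsHermitianForm ε g J where
  null : g ξ ξ = 0
  ne_zero : ξ ≠ 0
  swap : ∀ x y w, R x y w = -R y x w
  bianchi : ∀ x y w, R x y w + R y w x + R w x y = 0
  metric : ∀ x y w u, g (R x y w) u = -g (R x y u) w
  comm : ∀ x y w, R x y (J w) = J (R x y w)
  bianchi_action : ∀ x y z w, curvatureAction ε g J ξ ζ R x y z w
    + curvatureAction ε g J ξ ζ R y z x w + curvatureAction ε g J ξ ζ R z x y w = 0
  apply_xi : ∀ x y, R x y ξ = reductionCurvature ε g J ξ ζ x y ξ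
  apply_zeta : ∀ x y, R x y ζ = reductionCurvature ε g J ξ ζ x y ζ
  derivation : ∀ x y a b c,
    R x y (R a b c) - reductionCurvature ε g J ξ ζ x y (R a b c)
      = R (R x y a - reductionCurvature ε g J ξ ζ x y a) b c
      + R a (R x y b - reductionCurvature ε g J ξ ζ x y b) c
      + R a b (R x y c - reductionCurvature ε g J ξ ζ x y c)

namespace IsHermitianForm

variable {ε : ℝ} {g : V →ₗ[ℝ] V →ₗ[ℝ] ℝ} {J : V →ₗ[ℝ] V}

theorem eps_sq (h : IsHermitianForm ε g J) : ε * ε = 1 := by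
  rcases h.eps with h | h <;> rw [h] <;> norm_num

theorem form_J_J (h : IsHermitianForm ε g J) (x y : V) : g (J x) (J y) = -(ε * g x y) := by
  rw [h.skew, h.sq, map_smul, smul_eq_mul]

theorem form_J_swap (h : IsHermitianForm ε g J) (x y : V) : g x (J y) = -g y (J x) := by
  rw [h.symm, h.skew]

theorem form_J_self (h : IsHermitianForm ε g J) (x : V) : g x (J x) = 0 := by
  have := h.form_J_swap x x
  linarith

theorem eq_of_form_eq (h : IsHermitianForm ε g J) {x y : V} (hxy : ∀ u, g x u = g y u) :
    x = y := by
  rw [← sub_eq_zero]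
  apply h.nondegenerate
  intro u
  rw [map_sub, LinearMap.sub_apply, hxy, sub_self]

theorem neg (h : IsHermitianForm ε g J) : IsHermitianForm ε g (-J) where
  eps := h.eps
  symm := h.symm
  nondegenerate := h.nondegenerate
  skew x y := by simp [h.skew]
  sq x := by simp [h.sq]

end IsHermitianForm

/-- Every term of `S` that involves `J` contains it twice. This later reduces `Jξ = -ξ` to `Jξ = ξ`.
-/
theorem linearTypeTensor_neg (ε : ℝ) (g : V →ₗ[ℝ] V →ₗ[ℝ] ℝ) (J : V →ₗ[ℝ] V) (ξ ζ : V) :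
    linearTypeTensor ε g (-J) ξ ζ = linearTypeTensor ε g J ξ ζ := by
  ext x y
  simp [linearTypeTensor]

theorem reductionCurvature_neg (ε : ℝ) (g : V →ₗ[ℝ] V →ₗ[ℝ] ℝ) (J : V →ₗ[ℝ] V) (ξ ζ : V) :
    reductionCurvature ε g (-J) ξ ζ = reductionCurvature ε g J ξ ζ := by
  ext x y w
  simp only [reductionCurvature, linearTypeTensor_neg]

theorem curvatureAction_neg (ε : ℝ) (g : V →ₗ[ℝ] V →ₗ[ℝ] ℝ) (J : V →ₗ[ℝ] V) (ξ ζ : V)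
    (R : V →ₗ[ℝ] V →ₗ[ℝ] V →ₗ[ℝ] V) :
    curvatureAction ε g (-J) ξ ζ R = curvatureAction ε g J ξ ζ R := by
  ext x y z w
  simp only [curvatureAction, linearTypeTensor_neg]

namespace IsInfinitesimalModel

variable {ε : ℝ} {g : V →ₗ[ℝ] V →ₗ[ℝ] ℝ} {J : V →ₗ[ℝ] V} {ξ ζ : V}
  {R : V →ₗ[ℝ] V →ₗ[ℝ] V →ₗ[ℝ] V}

theorem neg (h : IsInfinitesimalModel ε g J ξ ζ R) : IsInfinitesimalModel ε g (-J) ξ ζ R where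
  toIsHermitianForm := h.toIsHermitianForm.neg
  null := h.null
  ne_zero := h.ne_zero
  swap := h.swap
  bianchi := h.bianchi
  metric := h.metric
  comm x y w := by simp [h.comm]
  bianchi_action := by simpa only [curvatureAction_neg] using h.bianchi_action
  apply_xi := by simpa only [reductionCurvature_neg] using h.apply_xi
  apply_zeta := by simpa only [reductionCurvature_neg] using h.apply_zeta
  derivation := by simpa only [reductionCurvature_neg] using h.derivation

theorem pair_symm (h : IsInfinitesimalModel ε g J ξ ζ R) (x y w u : V) :
    g (R x y w) u = g (R w u x) y := by
  have b : ∀ x y w u, g (R x y w) u + g (R y w x) u + g (R w x y) u = 0 := fun x y w u ↦ by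
    rw [← LinearMap.add_apply, ← LinearMap.add_apply, ← map_add, ← map_add, h.bianchi, map_zero,
      LinearMap.zero_apply]
  have s : ∀ x y w u, g (R x y w) u = -g (R y x w) u := fun x y w u ↦ by
    rw [h.swap, map_neg, LinearMap.neg_apply]
  have := b x y w u
  have := b y w u x
  have := b w u x y
  have := b u x y w
  have m := h.metric
  linarith [m x y w u, m y w x u, m w x y u, m y w u x, m w u y x, m u y w x, m w u x y,
    m u x w y, m x w u y, m u x y w, m x y u w, m y u x w, s x y w u, s y w x u, s w x y u,
    s y w u x, s w u y x, s u y w x, s w u x y, s u x w y, s x w u y, s u x y w, s x y u w,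
    s y u x w]

/-- Pair symmetry moves `J` from the first pair of arguments to the second, where `R` commutes with
`J` and `J` is skew. -/
theorem J_left (h : IsInfinitesimalModel ε g J ξ ζ R) (x y w : V) :
    R (J x) y w = -R x (J y) w := by
  apply h.eq_of_form_eq
  intro u
  rw [map_neg, LinearMap.neg_apply, h.pair_symm, h.comm, h.skew, h.pair_symm x]

set_option maxHeartbeats 1000000 in
/-- The second Bianchi identity after substituting `∇R = S · R`. -/
theorem cyclic_identity (h : IsInfinitesimalModel ε g J ξ ζ R) (x y z w u : V) :
    (2 * g ξ x * g (R y z w) u + 2 * ε * g x (J y) * g (R (J ξ) z w) u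
      + g x w * g (R y z ξ) u + ε * g x (J w) * g (R y z (J ξ)) u
      + g x u * g (R y z w) ξ + ε * g x (J u) * g (R y z w) (J ξ))
    + (2 * g ξ y * g (R z x w) u + 2 * ε * g y (J z) * g (R (J ξ) x w) u
      + g y w * g (R z x ξ) u + ε * g y (J w) * g (R z x (J ξ)) u
      + g y u * g (R z x w) ξ + ε * g y (J u) * g (R z x w) (J ξ))
    + (2 * g ξ z * g (R x y w) u + 2 * ε * g z (J x) * g (R (J ξ) y w) u
      + g z w * g (R x y ξ) u + ε * g z (J w) * g (R x y (J ξ)) u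
      + g z u * g (R x y w) ξ + ε * g z (J u) * g (R x y w) (J ξ)) = 0 := by
  have s : ∀ x y w, g (R x y w) u = -g (R y x w) u := fun x y w ↦ by
    rw [h.swap, map_neg, LinearMap.neg_apply]
  have jl : ∀ x y, g (R (J x) y w) u = g (R (J y) x w) u := fun x y ↦ by
    rw [h.J_left, map_neg, LinearMap.neg_apply, s x, neg_neg]
  have jr : ∀ y z a, g (R y z (J w)) a = -g (R y z w) (J a) := fun y z a ↦ by
    rw [h.comm, h.skew]
  have b : ∀ w u, g (R y z w) u + g (R z w y) u + g (R w y z) u = 0 := fun w u ↦ by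
    rw [← LinearMap.add_apply, ← LinearMap.add_apply, ← map_add, ← map_add, h.bianchi, map_zero,
      LinearMap.zero_apply]
  have b₁ : ∀ u, g (R y z x) u + g (R z x y) u + g (R x y z) u = 0 := b x
  have b₂ : ∀ u, g (R y z (J x)) u + g (R z x (J y)) u + g (R x y (J z)) u = 0 := fun u ↦ by
    simp only [h.comm, h.skew]
    linarith [b₁ (J u)]
  have expand : ∀ x y z, g (curvatureAction ε g J ξ ζ R x y z w) u =
      -g (R y z x) w * g ξ u - g (R y z w) ξ * g x u + ε * g (R y z (J x)) w * g (J ξ) u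
      - ε * g (R y z w) (J ξ) * g x (J u) + 2 * g ζ (J x) * g (R y z w) (J u)
      - (g x y * g (R ξ z w) u - g ξ y * g (R x z w) u + ε * g x (J y) * g (R (J ξ) z w) u
        - ε * g ξ (J y) * g (R (J x) z w) u - 2 * g ζ (J x) * g (R (J y) z w) u)
      + (g x z * g (R ξ y w) u - g ξ z * g (R x y w) u + ε * g x (J z) * g (R (J ξ) y w) u
        - ε * g ξ (J z) * g (R (J x) y w) u - 2 * g ζ (J x) * g (R (J z) y w) u)
      - (g x w * g (R y z ξ) u - g ξ w * g (R y z x) u + ε * g x (J w) * g (R y z (J ξ)) u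
        - ε * g ξ (J w) * g (R y z (J x)) u - 2 * g ζ (J x) * g (R y z (J w)) u) := by
    intro x y z
    have e₁ : g x (R y z w) = -g (R y z x) w := by rw [h.symm, h.metric]
    have e₂ : g ξ (R y z w) = g (R y z w) ξ := h.symm _ _
    have e₃ : ∀ a, g a (J (R y z w)) = -g (R y z w) (J a) := fun a ↦ by
      rw [h.symm, h.skew]
    have e₄ : g (R y z w) (J x) = -g (R y z (J x)) w := h.metric _ _ _ _
    rw [curvatureAction, h.swap y (linearTypeTensor ε g J ξ ζ x z)]
    simp only [linearTypeTensor, map_add, map_sub, map_smul, map_neg, LinearMap.add_apply,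
      LinearMap.sub_apply, LinearMap.smul_apply, LinearMap.neg_apply, smul_eq_mul]
    rw [e₁, e₂, e₃, e₃, e₄, h.skew (R y z w), h.skew x u]
    ring
  have key := congrArg (fun v ↦ g v u) (h.bianchi_action x y z w)
  simp only [map_add, LinearMap.add_apply, expand, map_zero, LinearMap.zero_apply] at key
  -- The terms carrying `g ξ u`, `g (J ξ) u`, `g ξ w` and `g ξ (J w)` sum to first Bianchi
  -- identities. Those carrying `ζ` cancel because `J` acts trivially on `R` as a derivation (`jr`,
  -- `jl`), and those with `R ξ` cancel by symmetry of `g`.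
  linear_combination -key - g ξ u * b₁ w + ε * g (J ξ) u * b₂ w
    + g ξ x * s y z w + g ξ y * s z x w + g ξ z * s x y w
    + ε * g (R (J ξ) z w) u * h.form_J_swap x y + ε * g (R (J ξ) x w) u * h.form_J_swap y z
    + ε * g (R (J ξ) y w) u * h.form_J_swap z x
    + ε * g ξ (J y) * jl x z - ε * g ξ (J x) * jl y z - ε * g ξ (J z) * jl x y
    + ε * g ξ (J w) * b₂ u + g ξ w * b₁ u
    + 2 * g ζ (J x) * (jr y z u + jl y z) + 2 * g ζ (J y) * (jr z x u - jl x z)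
    + 2 * g ζ (J z) * (jr x y u + jl x y)
    - g (R ξ z w) u * h.symm x y - g (R ξ y w) u * h.symm z x - g (R ξ x w) u * h.symm y z

end IsInfinitesimalModel

end PointwiseAlgebra

/-! ### Traces with respect to an indefinite form, and the contracted Bianchi identity -/

section Contraction

variable {V : Type*} [AddCommGroup V] [Module ℝ V]

/-- The Ricci form `tr (x ↦ R u x v)` of a trilinear map. -/
noncomputable def ricciForm (R : V →ₗ[ℝ] V →ₗ[ℝ] V →ₗ[ℝ] V) (u v : V) : ℝ :=
  LinearMap.trace ℝ V ((R u).flip v)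

variable {ε : ℝ} {g : V →ₗ[ℝ] V →ₗ[ℝ] ℝ} {J : V →ₗ[ℝ] V} {ξ ζ : V}
  {R : V →ₗ[ℝ] V →ₗ[ℝ] V →ₗ[ℝ] V}

theorem IsHermitianForm.exists_form_eq [FiniteDimensional ℝ V] (h : IsHermitianForm ε g J)
    (α : V →ₗ[ℝ] ℝ) : ∃ v, ∀ w, g v w = α w := by
  have hinj : Function.Injective (g : V →ₗ[ℝ] Dual ℝ V) := by
    rw [← LinearMap.ker_eq_bot, LinearMap.ker_eq_bot']
    intro v hv
    exact h.nondegenerate v fun w ↦ by rw [hv, LinearMap.zero_apply]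
  have hsurj : Function.Surjective (g : V →ₗ[ℝ] Dual ℝ V) :=
    (LinearMap.injective_iff_surjective_of_finrank_eq_finrank
      (Subspace.dual_finrank_eq (K := ℝ) (V := V)).symm).1 hinj
  obtain ⟨v, hv⟩ := hsurj α
  exact ⟨v, fun w ↦ by rw [hv]⟩

/-- A basis and its `g`-dual family replace an orthonormal frame, so that the signature plays no
role in computing traces. -/
theorem exists_dual_family [FiniteDimensional ℝ V] (h : IsHermitianForm ε g J)
    {ι : Type*} (b : Basis ι ℝ V) : ∃ b' : ι → V, ∀ i v, g (b' i) v = b.repr v i := by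
  choose b' hb using fun i ↦ h.exists_form_eq (b.coord i)
  exact ⟨b', fun i v ↦ by rw [hb, Basis.coord_apply]⟩

variable {ι : Type*} [Fintype ι] (b : Basis ι ℝ V) (b' : ι → V)

theorem sum_repr_eq_trace (A : V →ₗ[ℝ] V) : ∑ i, b.repr (A (b i)) i = LinearMap.trace ℝ V A := by
  classical
  rw [LinearMap.trace_eq_matrix_trace ℝ b, Matrix.trace]
  simp [LinearMap.toMatrix_apply]


variable {b b'}

theorem sum_form_dual_mul (hb : ∀ i v, g (b' i) v = b.repr v i) (α : V →ₗ[ℝ] ℝ) (v : V) :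
    ∑ i, g (b' i) v * α (b i) = α v := by
  conv_rhs => rw [← b.sum_repr v]
  simp only [hb, map_sum, map_smul, smul_eq_mul]

theorem IsHermitianForm.sum_form_mul (h : IsHermitianForm ε g J)
    (hb : ∀ i v, g (b' i) v = b.repr v i) (α : V →ₗ[ℝ] ℝ) (v : V) :
    ∑ i, g (b i) v * α (b' i) = α v := by
  have : ∑ i, g (b i) v • b' i = v := by
    apply h.eq_of_form_eq
    intro u
    rw [h.symm v u]
    conv_rhs => rw [← b.sum_repr u]
    simp only [hb, map_sum, map_smul, smul_eq_mul, LinearMap.sum_apply, LinearMap.smul_apply,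
      mul_comm]
  conv_rhs => rw [← this]
  simp

theorem sum_form_apply_dual (h : IsHermitianForm ε g J)
    (hb : ∀ i v, g (b' i) v = b.repr v i) (A : V →ₗ[ℝ] V) :
    ∑ i, g (A (b i)) (b' i) = LinearMap.trace ℝ V A := by
  rw [← sum_repr_eq_trace b]
  exact Finset.sum_congr rfl fun i _ ↦ by rw [h.symm, hb]

/-- The tensor `∑ b i ⊗ b' i` is the inverse metric, which is symmetric. -/
theorem IsHermitianForm.sum_dual_swap (h : IsHermitianForm ε g J)
    (hb : ∀ i v, g (b' i) v = b.repr v i) (F : V →ₗ[ℝ] V →ₗ[ℝ] ℝ) :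
    ∑ i, F (b i) (b' i) = ∑ i, F (b' i) (b i) := by
  have e₁ : ∀ i, F (b i) (b' i) = ∑ j, g (b' j) (b' i) * F (b i) (b j) := fun i ↦
    (sum_form_dual_mul hb (F (b i)) (b' i)).symm
  have e₂ : ∀ i, F (b' i) (b i) = ∑ j, g (b' j) (b' i) * F (b j) (b i) := fun i ↦
    (sum_form_dual_mul hb (F.flip (b i)) (b' i)).symm
  simp_rw [e₁, e₂]
  rw [Finset.sum_comm]
  exact Finset.sum_congr rfl fun i _ ↦ Finset.sum_congr rfl fun j _ ↦ by rw [h.symm]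

/-- The inverse metric inherits the skewness of `J` from `g`. -/
theorem IsHermitianForm.sum_dual_J (h : IsHermitianForm ε g J)
    (hb : ∀ i v, g (b' i) v = b.repr v i) (F : V →ₗ[ℝ] V →ₗ[ℝ] ℝ) :
    ∑ i, F (J (b i)) (b' i) = -∑ i, F (b i) (J (b' i)) := by
  have e₁ : ∀ i, F (J (b i)) (b' i) = ∑ j, g (b' j) (J (b i)) * F (b j) (b' i) := fun i ↦
    (sum_form_dual_mul hb (F.flip (b' i)) (J (b i))).symm
  have e₂ : ∀ i, F (b i) (J (b' i)) = ∑ j, g (b j) (J (b' i)) * F (b i) (b' j) := fun i ↦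
    (h.sum_form_mul hb (F (b i)) (J (b' i))).symm
  simp_rw [e₁, e₂]
  rw [Finset.sum_comm, ← Finset.sum_neg_distrib]
  refine Finset.sum_congr rfl fun i _ ↦ ?_
  rw [← Finset.sum_neg_distrib]
  refine Finset.sum_congr rfl fun j _ ↦ ?_
  rw [h.form_J_swap]
  ring

theorem IsHermitianForm.sum_form_self (h : IsHermitianForm ε g J)
    (hb : ∀ i v, g (b' i) v = b.repr v i) : ∑ i, g (b i) (b' i) = finrank ℝ V := by
  classical
  rw [finrank_eq_card_basis b]
  simp [h.symm _ (b' _), hb]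

theorem IsHermitianForm.sum_form_J (h : IsHermitianForm ε g J)
    (hb : ∀ i v, g (b' i) v = b.repr v i) : ∑ i, g (b i) (J (b' i)) = 0 := by
  have e₁ := h.sum_dual_J hb g
  have e₂ := h.sum_dual_swap hb (g ∘ₗ J)
  have e₃ : ∑ i, g (J (b' i)) (b i) = ∑ i, g (b i) (J (b' i)) :=
    Finset.sum_congr rfl fun i _ ↦ h.symm _ _
  simp only [LinearMap.comp_apply] at e₂
  linarith

namespace IsInfinitesimalModel

theorem sum_eq_ricciForm (h : IsInfinitesimalModel ε g J ξ ζ R)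
    (hb : ∀ i v, g (b' i) v = b.repr v i) (u v : V) :
    ∑ i, g (R u (b i) v) (b' i) = ricciForm R u v :=
  sum_form_apply_dual h.toIsHermitianForm hb ((R u).flip v)

theorem ricciForm_symm [FiniteDimensional ℝ V] (h : IsInfinitesimalModel ε g J ξ ζ R) (u v : V) :
    ricciForm R u v = ricciForm R v u := by
  obtain ⟨b', hb⟩ := exists_dual_family h.toIsHermitianForm (finBasis ℝ V)
  rw [← h.sum_eq_ricciForm hb, ← h.sum_eq_ricciForm hb]
  refine Eq.trans ?_ (h.sum_dual_swap hb (g ∘ₗ (R v).flip u)).symm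
  exact Finset.sum_congr rfl fun i _ ↦ h.pair_symm _ _ _ _

theorem ricciForm_J_J [FiniteDimensional ℝ V] (h : IsInfinitesimalModel ε g J ξ ζ R) (u v : V) :
    ricciForm R (J u) (J v) = -(ε * ricciForm R u v) := by
  obtain ⟨b', hb⟩ := exists_dual_family h.toIsHermitianForm (finBasis ℝ V)
  rw [← h.sum_eq_ricciForm hb, ← h.sum_eq_ricciForm hb]
  have := h.sum_dual_J hb ((g ∘ₗ (R u).flip v).compl₂ J)
  simp only [LinearMap.compl₂_apply, LinearMap.comp_apply, LinearMap.flip_apply, h.sq, map_smul,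
    smul_eq_mul, ← Finset.mul_sum] at this
  rw [← this]
  refine Finset.sum_congr rfl fun i _ ↦ ?_
  rw [h.comm, h.skew, h.J_left, map_neg, LinearMap.neg_apply, neg_neg]

/-- This is the trace of `cyclic_identity` over `x` and `u`. The factor `dim V + 2` collects `dim V`
from the trace of `g` and the remaining terms that reduce to `g (R y z w) ξ`. -/
theorem contracted_identity [FiniteDimensional ℝ V] (h : IsInfinitesimalModel ε g J ξ ζ R)
    (y z w : V) :
    (finrank ℝ V + 2) * g (R y z w) ξ + 2 * g ξ y * ricciForm R z w - 2 * g ξ z * ricciForm R y w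
      + 2 * ε * g y (J z) * ricciForm R (J ξ) w + g y w * ricciForm R z ξ
      - g z w * ricciForm R y ξ + ε * g y (J w) * ricciForm R z (J ξ)
      - ε * g z (J w) * ricciForm R y (J ξ) = 0 := by
  obtain ⟨b', hb⟩ := exists_dual_family h.toIsHermitianForm (finBasis ℝ V)
  set b := finBasis ℝ V
  have key : ∑ i, _ = ∑ i, (0 : ℝ) :=
    Finset.sum_congr rfl fun i _ ↦ h.cyclic_identity (b i) y z w (b' i)
  have c : ∀ v a : V, ∑ i, g (b i) v * g a (b' i) = g a v := fun v a ↦ h.sum_form_mul hb (g a) v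
  have c' : ∀ v a : V, ∑ i, g v (b' i) * g (R z (b i) w) a = g (R z v w) a := fun v a ↦ by
    simp_rw [h.symm v]
    exact sum_form_dual_mul hb (g.flip a ∘ₗ (R z).flip w) v
  have c'' : ∀ v a : V, ∑ i, g v (b' i) * g (R (b i) y w) a = g (R v y w) a := fun v a ↦ by
    simp_rw [h.symm v]
    exact sum_form_dual_mul hb (g.flip a ∘ₗ (R.flip y).flip w) v
  have r : ∀ u v, ∑ i, g (R u (b i) v) (b' i) = ricciForm R u v := h.sum_eq_ricciForm hb
  have r' : ∀ u v, ∑ i, g (R (b i) u v) (b' i) = -ricciForm R u v := fun u v ↦ by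
    rw [← r, ← Finset.sum_neg_distrib]
    exact Finset.sum_congr rfl fun i _ ↦ by rw [h.swap, map_neg, LinearMap.neg_apply]
  have n := h.sum_form_self hb
  have j := h.sum_form_J hb
  have jm : ∀ a, ∀ i, g a (J (b' i)) = -g (J a) (b' i) := fun a i ↦ by rw [h.skew, neg_neg]
  have jm' : ∀ i, g z (J (b i)) = -g (b i) (J z) := fun i ↦ h.form_J_swap _ _
  simp only [Finset.sum_add_distrib, mul_assoc, ← Finset.mul_sum, jm y, jm z, jm', h.symm ξ (b _),
    neg_mul, mul_neg, Finset.sum_neg_distrib, c, c', c'', r, r', Finset.sum_const_zero] at key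
  simp only [← Finset.sum_mul, n, j] at key
  have e₁ : g (R y z (J ξ)) (J w) = -(ε * g (R y z ξ) w) := by rw [h.comm, h.form_J_J]
  have e₂ : g (R z (J y) w) (J ξ) = -g (R (J z) y w) (J ξ) := by
    rw [h.J_left, map_neg, LinearMap.neg_apply, neg_neg]
  have e₃ : ∀ y z, g (R (J ξ) z w) (J y) = -g (R w (J y) ξ) (J z) := fun y z ↦ by
    rw [h.pair_symm, h.comm, h.skew]
  -- The first Bianchi identity for `J y`, `J z`, `w` merges the two terms that contain `R (J ξ)`
  -- into a multiple of `g (R y z w) ξ`.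
  have e₄ : g (R w (J y) ξ) (J z) - g (R w (J z) ξ) (J y) = -(ε * g (R y z w) ξ) := by
    have := congrArg (fun v ↦ g v ξ) (h.bianchi (J y) (J z) w)
    simp only [map_add, LinearMap.add_apply, map_zero, LinearMap.zero_apply] at this
    rw [h.J_left, h.sq, h.swap (J z), map_neg, map_neg, LinearMap.neg_apply, LinearMap.neg_apply,
      h.metric w (J z) _ ξ, h.metric w (J y) _ ξ] at this
    simp only [map_smul, LinearMap.smul_apply, smul_eq_mul] at this
    linarith
  have e₅ : g (R z y w) ξ = -g (R y z w) ξ := by rw [h.swap, map_neg, LinearMap.neg_apply]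
  rw [e₁, e₂, e₃, e₃, e₅] at key
  have es := h.eps_sq
  linear_combination key + 2 * ε * e₄ + es * (g (R y z ξ) w - 2 * g (R y z w) ξ)

end IsInfinitesimalModel

end Contraction
-- The pointwise classification: `ζ` and the Ricci form at a point
section PointwiseConclusion

variable {V : Type*} [AddCommGroup V] [Module ℝ V]
  {ε : ℝ} {g : V →ₗ[ℝ] V →ₗ[ℝ] ℝ} {J : V →ₗ[ℝ] V} {ξ ζ : V}
  {R : V →ₗ[ℝ] V →ₗ[ℝ] V →ₗ[ℝ] V}

theorem linearTypeTensor_add_right (x y z : V) :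
    linearTypeTensor ε g J ξ ζ x (y + z)
      = linearTypeTensor ε g J ξ ζ x y + linearTypeTensor ε g J ξ ζ x z := by
  simp only [linearTypeTensor, map_add]
  module

theorem linearTypeTensor_smul_right (a : ℝ) (x y : V) :
    linearTypeTensor ε g J ξ ζ x (a • y) = a • linearTypeTensor ε g J ξ ζ x y := by
  simp only [linearTypeTensor, map_smul, smul_eq_mul]
  module

theorem reductionCurvature_sub_smul (c : ℝ) (x y v w : V) :
    reductionCurvature ε g J ξ ζ x y (v - c • w)
      = reductionCurvature ε g J ξ ζ x y v - c • reductionCurvature ε g J ξ ζ x y w := by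
  simp only [reductionCurvature, sub_eq_add_neg, ← neg_smul, linearTypeTensor_add_right,
    linearTypeTensor_smul_right]
  module

/-- If `R z x w = α x • v₁ + β x • v₂` for all `x`, then `r (z, w) = α v₁ + β v₂`. -/
theorem ricciForm_eq_of_apply_eq [FiniteDimensional ℝ V] {z w v₁ v₂ : V} (α β : V →ₗ[ℝ] ℝ)
    (h : ∀ x, R z x w = α x • v₁ + β x • v₂) : ricciForm R z w = α v₁ + β v₂ := by
  have : (R z).flip w = α.smulRight v₁ + β.smulRight v₂ := by
    ext x
    simp [h]
  rw [ricciForm, this, map_add, LinearMap.trace_smulRight, LinearMap.trace_smulRight]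

namespace IsInfinitesimalModel

theorem form_xi_J_xi (h : IsInfinitesimalModel ε g J ξ ζ R) : g ξ (J ξ) = 0 :=
  h.form_J_self ξ

/-- Since `g ξ ξ = 0` and `g ξ (J ξ) = 0`, the terms along `x` and `J x` drop out. So `S_x`
preserves the span of `ξ` and `J ξ`, which makes `R_{yz} ξ` computable. -/
theorem linearTypeTensor_xi (h : IsInfinitesimalModel ε g J ξ ζ R) (x : V) :
    linearTypeTensor ε g J ξ ζ x ξ =
      g ξ x • ξ + (-(ε * g ξ (J x) + 2 * g ζ (J x))) • J ξ := by
  rw [linearTypeTensor, h.null, h.form_xi_J_xi, h.form_J_swap x ξ, h.symm x ξ]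
  module

theorem linearTypeTensor_J_xi (h : IsInfinitesimalModel ε g J ξ ζ R) (x : V) :
    linearTypeTensor ε g J ξ ζ x (J ξ) =
      g ξ x • J ξ + (-(g ξ (J x) + 2 * ε * g ζ (J x))) • ξ := by
  rw [linearTypeTensor, h.sq, map_smul, map_smul, h.null, h.form_xi_J_xi, h.form_J_swap x ξ,
    h.symm x ξ, smul_eq_mul, smul_eq_mul, ← mul_assoc, h.eps_sq]
  module

theorem curvature_xi (h : IsInfinitesimalModel ε g J ξ ζ R) (y z : V) :
    R y z ξ = (-2 * (g ζ (J y) * g ξ (J z) - g ζ (J z) * g ξ (J y))) • ξ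
      + (4 * (g ζ (J y) * g ξ z - g ζ (J z) * g ξ y) + 2 * (g ζ y * g ξ (J z) - g ζ z * g ξ (J y))
        + 4 * g ξ ζ * g (J y) z + 4 * ε * (g ζ (J y) * g ζ z - g ζ (J z) * g ζ y)) • J ξ := by
  rw [h.apply_xi, reductionCurvature]
  simp only [h.linearTypeTensor_xi, h.linearTypeTensor_J_xi, linearTypeTensor_add_right,
    linearTypeTensor_smul_right]
  have e₁ : g ξ (linearTypeTensor ε g J ξ ζ y z - linearTypeTensor ε g J ξ ζ z y) =
      -2 * (g ζ (J y) * g ξ (J z) - g ζ (J z) * g ξ (J y)) := by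
    simp only [linearTypeTensor, map_add, map_sub, map_smul, smul_eq_mul, h.null, h.form_xi_J_xi]
    ring
  have e₂ : g ξ (J (linearTypeTensor ε g J ξ ζ y z - linearTypeTensor ε g J ξ ζ z y)) =
      -(g ξ z * g ξ (J y)) + g ξ y * g ξ (J z)
      - ε * ε * (g ξ (J z) * g ξ y - g ξ (J y) * g ξ z)
      - 2 * ε * (g ζ (J y) * g ξ z - g ζ (J z) * g ξ y) := by
    simp only [linearTypeTensor, map_add, map_sub, map_smul, smul_eq_mul, h.null, h.form_xi_J_xi,
      h.sq]
    ring
  have e₃ : g ζ (J (linearTypeTensor ε g J ξ ζ y z - linearTypeTensor ε g J ξ ζ z y)) =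
      -(g ξ z * g ζ (J y)) + g ξ y * g ζ (J z) - 2 * g ξ ζ * (ε * ε) * g (J y) z
      - ε * ε * (g ξ (J z) * g ζ y - g ξ (J y) * g ζ z)
      - 2 * ε * (g ζ (J y) * g ζ z - g ζ (J z) * g ζ y) := by
    simp only [linearTypeTensor, map_add, map_sub, map_smul, smul_eq_mul, h.sq]
    rw [h.symm y z, h.form_J_swap z y, h.symm ζ ξ, h.skew]
    ring
  rw [e₁, e₂, e₃, h.eps_sq]
  match_scalars
  · linear_combination (-2 * (g ζ (J y) * g ξ (J z) - g ζ (J z) * g ξ (J y))) * h.eps_sq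
  · linear_combination (2 * (g ζ (J y) * g ξ z - g ζ (J z) * g ξ y)) * h.eps_sq

/-- Vectors adapted to `ξ` when `ξ` and `J ξ` are not proportional. -/
theorem exists_adapted_vector (h : IsInfinitesimalModel ε g J ξ ζ R)
    (hJ : ∀ c : ℝ, c * c = 1 → ε = 1 → J ξ ≠ c • ξ) : ∃ e, g ξ e = 1 ∧ g ξ (J e) = 0 := by
  -- Without such an `e`, the kernel of `g ξ ∘ J` lies in that of `g ξ`. The two forms are then
  -- proportional, so `ξ = -k J ξ` with `k² ε = 1`: impossible for `ε = -1` by sign and excluded by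
  -- `hJ` for `ε = 1`.
  by_contra! hcon
  have hker : ∀ v, g ξ (J v) = 0 → g ξ v = 0 := by
    intro v hv
    by_contra hne
    apply hcon ((g ξ v)⁻¹ • v)
    · rw [map_smul, smul_eq_mul, inv_mul_cancel₀ hne]
    · rw [map_smul, map_smul, hv, smul_zero]
  obtain ⟨u, hu⟩ : ∃ u, g ξ (J u) ≠ 0 := by
    by_contra! hcon
    exact h.ne_zero (h.nondegenerate _ fun v ↦ hker v (hcon v))
  have hprop : ∀ v, g ξ v = g ξ u / g ξ (J u) * g ξ (J v) := by
    intro v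
    have := hker (v - (g ξ (J v) / g ξ (J u)) • u) (by
      simp only [map_sub, map_smul, smul_eq_mul]; field_simp; ring)
    simp only [map_sub, map_smul, smul_eq_mul] at this
    linear_combination this
  set k := g ξ u / g ξ (J u)
  have hξ : ξ = (-k) • J ξ := h.eq_of_form_eq fun v ↦ by
    rw [hprop, map_smul, LinearMap.smul_apply, h.skew, smul_eq_mul]; ring
  have hJξ : J ξ = (-(k * ε)) • ξ := by
    conv_lhs => rw [hξ, map_smul, h.sq]
    module
  have hkk : (k * k * ε) • ξ = (1 : ℝ) • ξ := by
    conv_rhs => rw [hξ, hJξ]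
    module
  have hkk' : k * k * ε = 1 := smul_left_injective ℝ h.ne_zero hkk
  rcases h.eps with he | he
  · refine hJ (-(k * ε)) ?_ he hJξ
    rw [he] at hkk' ⊢; linarith
  · rw [he] at hkk'; nlinarith [mul_self_nonneg k]

/-- The `J`-invariance of `R` first places `ζ` in the span of `ξ` and `J ξ`. The contracted identity
at `y = e` then reduces the Ricci form to its value at `(e, e)`, and its `J`-invariance fixes that
value and removes the `J ξ` component of `ζ`. -/
theorem ricci_eq_of_adapted_vector [FiniteDimensional ℝ V]
    (h : IsInfinitesimalModel ε g J ξ ζ R) {e : V} (he : g ξ e = 1) (hJe : g ξ (J e) = 0) :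
    ∃ lam : ℝ, ζ = lam • ξ ∧ ∀ v w, ricciForm R v w =
      -(finrank ℝ V + 2) * lam * (ε + 2 * lam)
        * (g ξ v * g ξ w - ε * (g ξ (J v) * g ξ (J w))) := by
  have es := h.eps_sq
  set n : ℝ := (finrank ℝ V : ℝ)
  set p := g ζ e with hp
  set q := ε * g ζ (J e) with hq
  -- `R (J y) (J e) = -ε R y e`, applied to `ξ` and paired with `e`, is a linear equation for `g ζ
  -- y`; it says `ζ = p ξ - q J ξ`.
  have hz : ∀ y, g ζ y = p * g ξ y + q * g ξ (J y) := by
    intro y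
    have e₁ : R (J y) (J e) ξ = (-ε) • R y e ξ := by
      rw [h.J_left, h.sq, map_smul, LinearMap.smul_apply, neg_smul]
    have e₂ := congrArg (fun v ↦ g v e) e₁
    simp only [h.curvature_xi, map_add, map_smul, LinearMap.add_apply, LinearMap.smul_apply,
      h.skew ξ, he, hJe, h.sq, smul_eq_mul] at e₂
    linear_combination (-1 / 2) * e₂ + (g ζ e * g ξ y - g ζ y) * es
  have hzJ : ∀ y, g ζ (J y) = p * g ξ (J y) + ε * q * g ξ y := by
    intro y
    rw [hz, h.sq, map_smul, smul_eq_mul]; ring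
  have hzξ : g ξ ζ = 0 := by rw [h.symm, hz, h.null, h.form_xi_J_xi]; ring
  set B : ℝ := -2 * p - 4 * ε * p ^ 2 + 4 * q ^ 2 with hB
  have hR : ∀ y z, R y z ξ = (-2 * ε * q * (g ξ y * g ξ (J z) - g ξ z * g ξ (J y))) • ξ
      + (B * (g ξ y * g ξ (J z) - g ξ z * g ξ (J y))) • J ξ := by
    intro y z
    rw [h.curvature_xi, hzξ]
    congr 2
    · rw [hzJ, hzJ]; ring
    · rw [hzJ, hzJ, hz, hz]
      linear_combination 4 * (g ξ (J z) * g ξ y * q ^ 2 - g ξ (J y) * g ξ z * q ^ 2) * es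
  -- `R z x ξ` depends on `x` only through `g ξ x` and `g ξ (J x)`, and both forms vanish on `ξ` and
  -- `J ξ`.
  have hr : ∀ z, ricciForm R z ξ = 0 := by
    intro z
    rw [ricciForm_eq_of_apply_eq ((-2 * ε * q) • (g ξ z • (g ξ ∘ₗ J) - g ξ (J z) • g ξ))
      (B • (g ξ z • (g ξ ∘ₗ J) - g ξ (J z) • g ξ)) (v₁ := ξ) (v₂ := J ξ)]
    · simp [h.null, h.form_xi_J_xi, h.sq]
    · intro x
      rw [hR]
      simp only [LinearMap.smul_apply, LinearMap.sub_apply, LinearMap.comp_apply, smul_eq_mul,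
        mul_comm (g ξ x)]
  have hrJ : ∀ z, ricciForm R z (J ξ) = 0 := by
    intro z
    rw [ricciForm_eq_of_apply_eq ((-2 * ε * q) • (g ξ z • (g ξ ∘ₗ J) - g ξ (J z) • g ξ))
      ((B * ε) • (g ξ z • (g ξ ∘ₗ J) - g ξ (J z) • g ξ)) (v₁ := J ξ) (v₂ := ξ)]
    · simp [h.null, h.form_xi_J_xi, h.sq]
    · intro x
      rw [h.comm, hR, map_add, map_smul, map_smul, h.sq]
      simp only [LinearMap.smul_apply, LinearMap.sub_apply, LinearMap.comp_apply, smul_eq_mul,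
        mul_comm (g ξ x)]
      module
  have hric : ∀ z w, ricciForm R z w = g ξ z * ricciForm R e w
      - (n + 2) / 2 * g ξ (J z) * (2 * ε * q * g ξ w + B * g ξ (J w)) := by
    intro z w
    have := h.contracted_identity e z w
    rw [hr, hr, hrJ, hrJ, h.ricciForm_symm (J ξ), hrJ, he, h.metric, hR, he, hJe] at this
    simp only [map_add, map_smul, LinearMap.add_apply, LinearMap.smul_apply, h.skew ξ,
      smul_eq_mul] at this
    linear_combination this / 2
  have hre : ∀ w, ricciForm R e w = g ξ w * ricciForm R e e - (n + 2) * ε * q * g ξ (J w) := by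
    intro w
    rw [h.ricciForm_symm, hric, he, hJe]
    ring
  have hJJe : g ξ (J (J e)) = ε := by rw [h.sq, map_smul, he, smul_eq_mul, mul_one]
  -- Two evaluations of the Ricci form at `(J e, J e)`: by `J`-invariance and by `hric`.
  have hx : -(ε * ricciForm R e e) = -(n + 2) / 2 * B := by
    rw [← h.ricciForm_J_J, hric, hJe, hJJe]
    linear_combination (-(n + 2) / 2 * B) * es
  -- By `J`-invariance and symmetry the Ricci form at `(e, J e)` equals its own negative, whereas
  -- `hre` gives the value `-(n + 2) q`.
  have hq₀ : (n + 2) * q = 0 := by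
    have h₁ := h.ricciForm_J_J e (J e)
    rw [h.sq, h.ricciForm_symm] at h₁
    have h₂ : ricciForm R (ε • e) (J e) = ε * ricciForm R e (J e) := by
      have h₃ : (R (ε • e)).flip (J e) = ε • (R e).flip (J e) := by rw [map_smul]; rfl
      rw [ricciForm, h₃, map_smul, smul_eq_mul, ricciForm]
    rw [h₂, hre (J e), hJe, hJJe] at h₁
    linear_combination (-1 / 2) * ε * h₁ - (ε ^ 2 + 1) * (n + 2) * q * es
  have hq₁ : q = 0 := (mul_eq_zero.1 hq₀).resolve_left (by positivity)
  refine ⟨p, ?_, fun v w ↦ ?_⟩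
  · refine h.eq_of_form_eq fun u ↦ ?_
    rw [hz, hq₁, map_smul, LinearMap.smul_apply, smul_eq_mul]
    ring
  · rw [hric, hre, hB, hq₁]
    rw [hB, hq₁] at hx
    linear_combination (-ε * g ξ v * g ξ w) * hx - (g ξ v * g ξ w * ricciForm R e e
      + 2 * (n + 2) * p ^ 2 * (g ξ v * g ξ w) + (n + 2) * p * (g ξ (J w) * g ξ (J v))) * es

/-- If `J ξ = ξ` then `ξ` and `ζ` are proportional and the Ricci form vanishes. -/
theorem ricci_eq_zero_of_J_xi [FiniteDimensional ℝ V] (hn : 4 ≤ finrank ℝ V)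
    (h : IsInfinitesimalModel 1 g J ξ ζ R) (hJ : J ξ = ξ) :
    ∃ lam : ℝ, ζ = lam • ξ ∧ ∀ v w, ricciForm R v w = 0 := by
  have hφ : ∀ x, g ξ (J x) = -g ξ x := fun x ↦ by
    have := h.skew ξ x
    rw [hJ] at this
    linarith
  have hJJ : ∀ x, J (J x) = x := fun x ↦ by rw [h.sq, one_smul]
  -- The `±1` eigenspaces of `J` are totally null and paired by `g`. As `ξ` lies in the `+1`
  -- eigenspace, a vector dual to it exists in the other one.
  obtain ⟨e, he, hJe⟩ : ∃ e, g ξ e = 1 ∧ J e = -e := by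
    obtain ⟨u, hu⟩ : ∃ u, g ξ u ≠ 0 := by
      by_contra! hcon
      exact h.ne_zero (h.nondegenerate _ hcon)
    refine ⟨(1 / (2 * g ξ u)) • (u - J u), ?_, ?_⟩
    · rw [map_smul, map_sub, hφ, smul_eq_mul]; field_simp; ring
    · rw [map_smul, map_sub, hJJ]; module
  have hee : g e e = 0 := by
    have := h.form_J_J e e
    rw [hJe, map_neg, map_neg, LinearMap.neg_apply] at this
    linarith
  set c := g ζ e with hc
  have hzJ₀ : ∀ x, g ζ (J x) = g ζ x - 2 * c * g ξ x := by
    intro x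
    have e₁ : R (J x) e ξ = R x e ξ := by
      rw [h.J_left, hJe, map_neg, LinearMap.neg_apply, neg_neg]
    have e₂ := congrArg (fun v ↦ g v e) e₁
    simp only [h.curvature_xi, hJ, hφ, map_add, map_smul, map_neg, LinearMap.add_apply,
      LinearMap.smul_apply, h.skew x e, he, hJe, hJJ, smul_eq_mul] at e₂
    linear_combination (-1 / 8) * e₂
  -- `η` is the part of `ζ` to be shown zero. By `hηJ` it lies in the `-1` eigenspace, and `g η e =
  -- 0`.
  obtain ⟨η, hη⟩ : ∃ η, η = ζ - c • ξ := ⟨_, rfl⟩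
  have hz : ∀ x, g ζ x = g η x + c * g ξ x := fun x ↦ by
    rw [hη, map_sub, map_smul, LinearMap.sub_apply, LinearMap.smul_apply, smul_eq_mul]; ring
  have hzJ : ∀ x, g ζ (J x) = g η x - c * g ξ x := fun x ↦ by rw [hzJ₀, hz]; ring
  have hηJ : ∀ x, g η (J x) = g η x := fun x ↦ by
    have := hz (J x)
    rw [hzJ, hφ] at this
    linarith
  have hηe : g η e = 0 := by
    have := hz e
    rw [he, ← hc] at this
    linarith
  set t := g ξ η with ht
  have htζ : g ξ ζ = t := by rw [h.symm, hz, h.null, h.symm]; ring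
  set μ := 4 * (1 + 2 * c) with hμ
  have hR₀ : ∀ x y, R x y ξ
      = (μ * (g η x * g ξ y - g η y * g ξ x) + 4 * t * g (J x) y) • ξ := by
    intro x y
    rw [h.curvature_xi, hJ, ← add_smul, htζ, hzJ, hzJ, hφ, hφ, hz x, hz y, hμ]
    congr 1
    ring
  have hr₀ : ∀ z, ricciForm R z ξ = -(t * (μ + 4)) * g ξ z := by
    intro z
    rw [ricciForm_eq_of_apply_eq (μ • (g η z • g ξ - g ξ z • g η) + (4 * t) • g (J z)) 0
      (v₁ := ξ) (v₂ := 0)]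
    · simp only [LinearMap.add_apply, LinearMap.smul_apply, LinearMap.sub_apply, smul_eq_mul,
        h.null, h.skew z, hJ, h.symm z ξ, h.symm η ξ, LinearMap.zero_apply, ← ht]
      ring
    · intro x
      rw [hR₀]
      simp only [LinearMap.add_apply, LinearMap.smul_apply, LinearMap.sub_apply, smul_eq_mul,
        mul_comm (g ξ z), smul_zero, add_zero]
  -- A pair of opposite eigenvectors orthogonal to `ξ`, with nonzero product. If every vector
  -- orthogonal to `ξ` were fixed by `J`, nullity of that eigenspace would force `V` to be spanned
  -- by `ξ` and `e`, against `dim V ≥ 4`.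
  obtain ⟨A, B, hA, hB, hBξ, hAB⟩ : ∃ A B, J A = A ∧ J B = -B ∧ g ξ B = 0 ∧ g B A ≠ 0 := by
    obtain ⟨x, hx, hJx⟩ : ∃ x, g ξ x = 0 ∧ J x ≠ x := by
      by_contra! hcon
      have hx : ∀ x, g ξ x = 0 → x = g x e • ξ := by
        intro x hx
        refine h.eq_of_form_eq fun u ↦ ?_
        have hu : g ξ (u - g ξ u • e) = 0 := by
          rw [map_sub, map_smul, he, smul_eq_mul, mul_one, sub_self]
        have := h.form_J_J x (u - g ξ u • e)
        rw [hcon x hx, hcon _ hu] at this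
        simp only [map_sub, map_smul, LinearMap.smul_apply, smul_eq_mul] at this ⊢
        linarith
      have hspan : Submodule.span ℝ ({ξ, e} : Set V) = ⊤ := by
        rw [eq_top_iff]
        intro v _
        have hv := hx (v - g ξ v • e) (by
          rw [map_sub, map_smul, he, smul_eq_mul, mul_one, sub_self])
        rw [Submodule.mem_span_pair]
        exact ⟨_, _, by rw [← hv, sub_add_cancel]⟩
      classical
      have hcard := finrank_span_finset_le_card (R := ℝ) ({ξ, e} : Finset V)
      rw [Set.finrank, Finset.coe_pair, hspan, finrank_top] at hcard
      have := Finset.card_le_two (a := ξ) (b := e)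
      omega
    have hne : x - J x ≠ 0 := fun h' ↦ hJx (sub_eq_zero.1 h').symm
    obtain ⟨v, hv⟩ : ∃ v, g (x - J x) v ≠ 0 := by
      by_contra! hcon
      exact hne (h.nondegenerate _ hcon)
    have hB : J (x - J x) = -(x - J x) := by rw [map_sub, hJJ, neg_sub]
    refine ⟨v + J v, x - J x, by rw [map_add, hJJ, add_comm], hB, ?_, ?_⟩
    · rw [map_sub, hφ, hx, neg_zero, sub_zero]
    · have := h.skew (x - J x) v
      rw [hB, map_neg, LinearMap.neg_apply, neg_inj] at this
      rw [map_add, ← this]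
      intro h'
      apply hv
      linarith
  have hAξ : g ξ A = 0 := by
    have := hφ A
    rw [hA] at this
    linarith
  have hrA : ricciForm R A ξ = 0 := by rw [hr₀, hAξ, mul_zero]
  have hrB : ricciForm R B ξ = 0 := by rw [hr₀, hBξ, mul_zero]
  -- At `(A, e, B)` the two terms with `ricciForm R e ξ` cancel and leave `ricciForm R A B = 0`; at
  -- `(B, e, A)` they add up.
  have hre : ricciForm R e ξ = 0 := by
    have e₁ := h.contracted_identity A e B
    have e₂ := h.contracted_identity B e A
    rw [hJ, h.metric, hR₀, map_smul, LinearMap.smul_apply, hBξ, hAξ, hrA, he, hJe, hB,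
      h.ricciForm_symm ξ, hrB] at e₁
    rw [hJ, h.metric, hR₀, map_smul, LinearMap.smul_apply, hBξ, hAξ, hrB, he, hJe, hA,
      h.ricciForm_symm ξ, hrA, h.ricciForm_symm B A] at e₂
    simp only [map_neg, smul_eq_mul] at e₁ e₂
    have : g B A * ricciForm R e ξ = 0 := by linarith
    exact (mul_eq_zero.1 this).resolve_left hAB
  have ht₀ : t = 0 := by
    have e₁ := h.contracted_identity A B e
    rw [hJ, h.metric, hR₀, map_smul, LinearMap.smul_apply, hBξ, hAξ, hrA, he, hJe, hA,
      h.ricciForm_symm ξ, hrB, hre, h.symm A B] at e₁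
    simp only [smul_eq_mul] at e₁
    have : ((finrank ℝ V : ℝ) + 2) * (g B A * t) = 0 := by linarith
    exact (mul_eq_zero.1 ((mul_eq_zero.1 this).resolve_left (by positivity))).resolve_left hAB
  have hR : ∀ x y, R x y ξ = (μ * (g η x * g ξ y - g η y * g ξ x)) • ξ := by
    intro x y
    rw [hR₀, ht₀, mul_zero, zero_mul, add_zero]
  have hr : ∀ z, ricciForm R z ξ = 0 := by
    intro z
    rw [hr₀, ht₀, zero_mul, neg_zero, zero_mul]
  -- A nonzero `η` is refuted by two relations in `c`: the cyclic identity forces `c = -1`, while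
  -- invariance of `R` under the curvature of the reduced connection forces `c = 0`.
  have hη₀ : η = 0 := by
    by_contra hne
    obtain ⟨w, hw, hJw⟩ : ∃ w, g η w = 1 ∧ J w = w := by
      obtain ⟨u, hu⟩ : ∃ u, g η u ≠ 0 := by
        by_contra! hcon
        exact hne (h.nondegenerate _ hcon)
      refine ⟨(1 / (2 * g η u)) • (u + J u), ?_, ?_⟩
      · rw [map_smul, map_add, hηJ, smul_eq_mul]; field_simp; ring
      · rw [map_smul, map_add, hJJ]; module
    have hJη : J η = -η := h.eq_of_form_eq fun u ↦ by
      rw [h.skew, hηJ, map_neg, LinearMap.neg_apply]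
    have hηη : g η η = 0 := by
      have := hηJ η
      rw [hJη, map_neg] at this
      linarith
    have hwξ : g ξ w = 0 := by
      have := hφ w
      rw [hJw] at this
      linarith
    have hww : g w w = 0 := by
      have := h.form_J_J w w
      rw [hJw] at this
      linarith
    have hSη : ∀ x, linearTypeTensor 1 g J ξ ζ x η = (2 * (g η x - c * g ξ x)) • η := by
      intro x
      rw [linearTypeTensor, hJη, map_neg, map_neg, ← ht, ht₀, hJ, hzJ]
      module
    have hRη : ∀ x y, R x y η = (-8 * c * (g η x * g ξ y - g η y * g ξ x)) • η := by
      intro x y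
      have e₁ : R x y η = reductionCurvature 1 g J ξ ζ x y η := by
        rw [hη, reductionCurvature_sub_smul, map_sub, map_smul, h.apply_zeta, h.apply_xi]
      rw [e₁, reductionCurvature]
      simp only [hSη, linearTypeTensor_smul_right]
      have e₂ : g ξ (linearTypeTensor 1 g J ξ ζ x y - linearTypeTensor 1 g J ξ ζ y x)
          = 2 * (g η x * g ξ y - g η y * g ξ x) := by
        simp only [linearTypeTensor, map_add, map_sub, map_smul, smul_eq_mul, h.null, hJ, hφ, hzJ]
        ring
      have e₃ : g η (linearTypeTensor 1 g J ξ ζ x y - linearTypeTensor 1 g J ξ ζ y x)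
          = -2 * c * (g η x * g ξ y - g η y * g ξ x) := by
        simp only [linearTypeTensor, map_add, map_sub, map_smul, smul_eq_mul, hJ, hφ, hzJ,
          hηJ, h.symm η ξ, ← ht, ht₀]
        ring
      rw [e₂, e₃]
      module
    have hηξ : g ξ η = 0 := ht₀
    have hK : g (R η w w) e = -8 * c := by
      rw [h.pair_symm, hRη, map_smul, LinearMap.smul_apply, hw, he, hwξ, smul_eq_mul]
      ring
    have hwe : g (R w e ξ) e = μ := by
      rw [hR, map_smul, LinearMap.smul_apply, hw, he, hwξ, smul_eq_mul]
      ring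
    have hew : g (R e w ξ) e = -μ := by
      rw [h.swap, map_neg, LinearMap.neg_apply, hwe]
    have hξe : g (R ξ e w) e = μ := by rw [h.pair_symm, hwe]
    have hμc : μ = 4 * c := by
      have key := h.cyclic_identity e η w w e
      have e₁ : g (R ξ η w) e = 0 := by
        rw [h.pair_symm, hR, map_smul, LinearMap.smul_apply, hηξ, smul_zero]
      have e₂ : R η w ξ = 0 := by rw [hR, hηη, hηξ, hwξ]; simp
      have e₃ : g e η = 0 := by rw [h.symm, hηe]
      simp only [hJ, hJη, hJe, hJw, map_neg, he, hee, hηξ, hwξ, hww, hw, hηe, hK, hwe, hξe, e₁, e₂,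
        e₃, map_zero, LinearMap.zero_apply] at key
      linarith
    have hS : ∀ v, reductionCurvature 1 g J ξ ζ e η v
        = (-4 * c * g η v) • ξ + (4 * c * g ξ v) • η := by
      have se : ∀ v, linearTypeTensor 1 g J ξ ζ e v
          = (2 * g e v) • ξ + (-2 * g ξ v) • e + (2 * c) • J v := by
        intro v
        have : g e (J v) = g e v := by
          have := h.skew e v
          rw [hJe, map_neg, LinearMap.neg_apply, neg_inj] at this
          exact this.symm
        rw [linearTypeTensor, this, hJ, hφ, hJe, map_neg, ← hc]
        module
      have sη : ∀ v, linearTypeTensor 1 g J ξ ζ η v = (2 * g η v) • ξ + (-2 * g ξ v) • η := by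
        intro v
        rw [linearTypeTensor, hηJ, hJ, hφ, hzJ, hηη, hηξ, hJη]
        module
      intro v
      have e₁ : linearTypeTensor 1 g J ξ ζ e η - linearTypeTensor 1 g J ξ ζ η e
          = (2 - 2 * c) • η := by
        rw [se, sη, hηξ, hJη, h.symm e η, hηe, he]
        module
      have e₂ : linearTypeTensor 1 g J ξ ζ ((2 - 2 * c) • η) v
          = (2 - 2 * c) • linearTypeTensor 1 g J ξ ζ η v := by
        simp only [linearTypeTensor, map_smul, LinearMap.smul_apply, smul_eq_mul]
        module
      rw [reductionCurvature, e₁, e₂, sη]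
      simp only [se, sη, hηξ, hηe, he, h.null, hJ, hJη, h.symm η ξ, h.symm e ξ, h.symm e η, hηJ,
        hφ, map_add, map_smul, smul_eq_mul]
      module
    -- `e` and `η` are in the same eigenspace of `J`, so `J_left` gives `R e η = -R e η`.
    have hReη : ∀ v, R e η v = 0 := by
      intro v
      have := h.J_left e η v
      rw [hJe, hJη, map_neg, map_neg, LinearMap.neg_apply, LinearMap.neg_apply, neg_neg] at this
      have h' : (2 : ℝ) • R e η v = 0 := by
        rw [two_smul]
        nth_rewrite 1 [← this]
        exact neg_add_cancel _
      exact (smul_eq_zero.1 h').resolve_left two_ne_zero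
    -- As `R e η = 0`, only the explicit operator `hS` acts on `R`. Evaluation on `e, w, w`, paired
    -- with `e`, gives `-32c² = 32c² - 8cμ`.
    have hder := congrArg (fun v ↦ g v e) (h.derivation e η e w w)
    have hQη : g η (R e w w) = -8 * c := by
      rw [h.symm, h.metric, hRη, map_smul, LinearMap.smul_apply, hηe, hw, he, hwξ, smul_eq_mul]
      ring
    have hQξ : g ξ (R e w w) = 0 := by
      rw [h.symm, h.metric, hR, map_smul, LinearMap.smul_apply, hwξ, smul_zero, neg_zero]
    have heξ : g (R e ξ w) e = -μ := by
      rw [h.swap, map_neg, LinearMap.neg_apply, hξe]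
    simp only [hReη, hS, hw, hwξ, hηe, he, hQη, hQξ, zero_sub, map_neg, map_add, map_smul,
      LinearMap.neg_apply, LinearMap.add_apply, LinearMap.smul_apply, smul_eq_mul, hK, heξ,
      hew] at hder
    have hc₁ : c = -1 := by linarith
    rw [hμc, hc₁] at hder
    norm_num at hder
  refine ⟨c, ?_, ?_⟩
  · rw [hη] at hη₀
    exact sub_eq_zero.1 hη₀
  · have hR' : ∀ x y, R x y ξ = 0 := fun x y ↦ by
      rw [hR, hη₀]
      simp
    have hre' : ∀ z w, ricciForm R z w = g ξ z * ricciForm R e w := by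
      intro z w
      have := h.contracted_identity e z w
      rw [hJ, h.ricciForm_symm ξ, hr, hr, hr, h.metric, hR', he, map_zero,
        LinearMap.zero_apply] at this
      linarith
    -- Since `J e = -e` and `ε = 1`, `J`-invariance makes this value its own negative.
    have hee' : ricciForm R e e = 0 := by
      have e₁ := h.ricciForm_J_J e e
      rw [hJe, hre', map_neg, he, h.ricciForm_symm e, hre', map_neg, he] at e₁
      linarith
    intro v w
    rw [hre', h.ricciForm_symm, hre', hee', mul_zero, mul_zero]

/-- The pointwise form of the classification of degenerate structures of linear type. -/
theorem exists_eq_smul_and_ricci_eq [FiniteDimensional ℝ V] (hn : 4 ≤ finrank ℝ V)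
    (h : IsInfinitesimalModel ε g J ξ ζ R) :
    ∃ lam : ℝ, ζ = lam • ξ ∧ ∀ v w, ricciForm R v w =
      -(finrank ℝ V + 2) * lam * (ε + 2 * lam)
        * (g ξ v * g ξ w - ε * (g ξ (J v) * g ξ (J w))) := by
  by_cases hJ : ∀ c : ℝ, c * c = 1 → ε = 1 → J ξ ≠ c • ξ
  · obtain ⟨e, he, hJe⟩ := h.exists_adapted_vector hJ
    exact h.ricci_eq_of_adapted_vector he hJe
  · push Not at hJ
    obtain ⟨c, hc, rfl, hξ⟩ := hJ
    have hφ : ∀ x, g ξ (J x) = -c * g ξ x := fun x ↦ by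
      have := h.skew ξ x
      rw [hξ, map_smul, LinearMap.smul_apply, smul_eq_mul] at this
      linarith
    -- For `J ξ = c ξ` with `c = ±1` the claimed right-hand side is zero, and `c = -1` becomes `c =
    -- 1` on replacing `J` by `-J`.
    have key : ∃ lam : ℝ, ζ = lam • ξ ∧ ∀ v w, ricciForm R v w = 0 := by
      rcases mul_self_eq_one_iff.1 hc with rfl | rfl
      · exact h.ricci_eq_zero_of_J_xi hn (by rw [hξ, one_smul])
      · exact h.neg.ricci_eq_zero_of_J_xi hn (by rw [LinearMap.neg_apply, hξ]; module)
    obtain ⟨lam, hlam, hr⟩ := key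
    refine ⟨lam, hlam, fun v w ↦ ?_⟩
    rw [hr, hφ, hφ]
    linear_combination (-(finrank ℝ V + 2) * lam * (1 + 2 * lam) * g ξ v * g ξ w) * hc

end IsInfinitesimalModel

end PointwiseConclusion

/-! ### Recovering the vectors from a linear-type tensor; contraction with the Gram matrix -/

section TraceLemmas

variable {V : Type*} [AddCommGroup V] [Module ℝ V]
  {ε : ℝ} {g : V →ₗ[ℝ] V →ₗ[ℝ] ℝ} {J : V →ₗ[ℝ] V}

/-- In dimension at least four a linear-type tensor determines the vectors defining it. -/
theorem IsHermitianForm.eq_zero_of_linearTypeTensor_eq_zero [FiniteDimensional ℝ V]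
    (hn : 4 ≤ finrank ℝ V) (h : IsHermitianForm ε g J) {u v : V}
    (huv : ∀ x y, linearTypeTensor ε g J u v x y = 0) : u = 0 ∧ v = 0 := by
  obtain ⟨b', hb⟩ := exists_dual_family h (finBasis ℝ V)
  set b := finBasis ℝ V
  have es := h.eps_sq
  have c₁ : ∀ (α : V →ₗ[ℝ] ℝ) w, ∑ i, α (b i) * g w (b' i) = α w := fun α w ↦ by
    rw [← sum_form_dual_mul hb α w]
    exact Finset.sum_congr rfl fun i _ ↦ by rw [h.symm w, mul_comm]
  have c₂ : ∀ v w, ∑ i, g v (J (b i)) * g w (b' i) = g v (J w) := fun v ↦ c₁ (g v ∘ₗ J)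
  have n := h.sum_form_self hb
  have j := h.sum_form_J hb
  -- The trace of `x ↦ S_x z`. With `t₂`, the trace of `S_y` against `J`, it forms a linear system
  -- in `u` and `v` whose determinant is a multiple of `n² - 4`, nonzero for `n ≥ 4`.
  have t₁ : ∀ z, -(finrank ℝ V : ℝ) * g u z - 2 * ε * g v z = 0 := by
    intro z
    have key : ∑ i, g (linearTypeTensor ε g J u v (b i) z) (b' i) = 0 := by simp [huv]
    have : ∀ i, g (linearTypeTensor ε g J u v (b i) z) (b' i) =
        g z (b i) * g u (b' i) - g u z * g (b i) (b' i) + ε * (g (J z) (b i) * g (J u) (b' i))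
        + ε * g u (J z) * g (b i) (J (b' i)) - 2 * (g v (J (b i)) * g (J z) (b' i)) := by
      intro i
      simp only [linearTypeTensor, map_add, map_sub, map_smul, LinearMap.add_apply,
        LinearMap.sub_apply, LinearMap.smul_apply, smul_eq_mul,
        h.skew (b i), h.symm (b i) z, h.symm (b i) (J z)]
      ring
    simp only [this, Finset.sum_add_distrib, Finset.sum_sub_distrib, ← Finset.mul_sum, c₁, c₂, n, j,
      h.sq, map_smul, smul_eq_mul, h.form_J_J] at key
    rw [h.symm z u] at key
    linear_combination key + g u z * es
  have t₂ : ∀ y, 4 * g u (J y) + 2 * ε * finrank ℝ V * g v (J y) = 0 := by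
    intro y
    have key : ∑ i, g (linearTypeTensor ε g J u v y (b i)) (J (b' i)) = 0 := by simp [huv]
    have : ∀ i, g (linearTypeTensor ε g J u v y (b i)) (J (b' i)) =
        -(g y (b i) * g (J u) (b' i)) + g u (b i) * g (J y) (b' i)
        - (ε * ε) * (g y (J (b i)) * g u (b' i)) + (ε * ε) * (g u (J (b i)) * g y (b' i))
        + 2 * ε * g v (J y) * g (b i) (b' i) := by
      intro i
      simp only [linearTypeTensor, map_add, map_sub, map_smul, LinearMap.add_apply,
        LinearMap.sub_apply, LinearMap.smul_apply, smul_eq_mul, h.form_J_J]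
      rw [h.skew u, h.skew y]
      ring
    simp only [this, Finset.sum_add_distrib, Finset.sum_sub_distrib, Finset.sum_neg_distrib,
      ← Finset.mul_sum, c₁, c₂, n] at key
    rw [h.form_J_swap y u] at key
    linear_combination key - 2 * g u (J y) * es
  have t₃ : ∀ z, g v z = 0 := by
    intro z
    have e₁ := t₁ z
    have e₂ := t₂ (J z)
    rw [h.sq, map_smul, map_smul, smul_eq_mul, smul_eq_mul] at e₂
    have e₃ : (((finrank ℝ V : ℝ) ^ 2 - 4)) * g v z = 0 := by
      linear_combination 2 * ε * e₁ + (finrank ℝ V : ℝ) / 2 * e₂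
        - ((finrank ℝ V : ℝ) ^ 2 - 4) * g v z * es
    have : (4 : ℝ) ≤ finrank ℝ V := by exact_mod_cast hn
    exact (mul_eq_zero.1 e₃).resolve_left (by nlinarith)
  refine ⟨h.nondegenerate u fun z ↦ ?_, h.nondegenerate v t₃⟩
  have e₁ := t₁ z
  have : (4 : ℝ) ≤ finrank ℝ V := by exact_mod_cast hn
  rw [t₃, mul_zero, sub_zero] at e₁
  exact (mul_eq_zero.1 e₁).resolve_left (by linarith)

/-- Contraction of `g(v, ·) ⊗ g(v, ·)` with the inverse of the Gram matrix of a basis. -/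
theorem IsHermitianForm.sum_gram_inv_mul {ι : Type*} [Fintype ι] [DecidableEq ι]
    (h : IsHermitianForm ε g J) (b : Basis ι ℝ V) (G : Matrix ι ι ℝ)
    (hG : ∀ i j, G i j = g (b i) (b j)) (v : V) :
    ∑ i, ∑ j, G⁻¹ i j * (g v (b i) * g v (b j)) = g v v := by
  have hmul : ∀ c : ι → ℝ, ∀ i, G.mulVec c i = g (∑ j, c j • b j) (b i) := by
    intro c i
    simp only [Matrix.mulVec, dotProduct, hG, map_sum, map_smul, LinearMap.sum_apply,
      LinearMap.smul_apply, smul_eq_mul]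
    exact Finset.sum_congr rfl fun j _ ↦ by rw [h.symm, mul_comm]
  have hunit : IsUnit G := by
    rw [← Matrix.mulVec_injective_iff_isUnit]
    refine (injective_iff_map_eq_zero G.mulVecLin).2 fun c hc ↦ ?_
    have hz : ∑ j, c j • b j = 0 := h.nondegenerate _ fun w ↦ by
      rw [← b.sum_repr w, map_sum]
      refine Finset.sum_eq_zero fun i _ ↦ ?_
      rw [map_smul, ← hmul c i]
      have := congrFun hc i
      rw [Matrix.mulVecLin_apply] at this
      rw [this, Pi.zero_apply, smul_zero]
    exact funext (Fintype.linearIndependent_iff.1 b.linearIndependent c hz)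
  have hv : (fun j ↦ g v (b j)) = G.mulVec (b.repr v) := by
    ext i
    rw [hmul, b.sum_repr]
  have hinv : G⁻¹.mulVec (fun j ↦ g v (b j)) = b.repr v := by
    rw [hv, Matrix.mulVec_mulVec,
      Matrix.nonsing_inv_mul _ ((Matrix.isUnit_iff_isUnit_det G).1 hunit),
      Matrix.one_mulVec]
  calc ∑ i, ∑ j, G⁻¹ i j * (g v (b i) * g v (b j))
      = ∑ i, g v (b i) * G⁻¹.mulVec (fun j ↦ g v (b j)) i := by
        refine Finset.sum_congr rfl fun i _ ↦ ?_
        rw [Matrix.mulVec, dotProduct, Finset.mul_sum]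
        exact Finset.sum_congr rfl fun j _ ↦ by ring
    _ = g v v := by
        rw [hinv]
        conv_rhs => arg 2; rw [← b.sum_repr v]
        simp only [map_sum, map_smul, smul_eq_mul, mul_comm]

end TraceLemmas

/-! ### Smooth vector fields, locality, and global extension of tangent vectors -/

section SmoothFields

open Topology Filter

variable {E : Type*} [NormedAddCommGroup E] [NormedSpace ℝ E]
  {M : Type*} [TopologicalSpace M] [ChartedSpace E M] [IsManifold 𝓘(ℝ, E) ∞ M]

theorem SmoothField.mdifferentiableAt {X : VField E M} (hX : SmoothField X) (p : M) :
    MDifferentiableAt 𝓘(ℝ, E) (𝓘(ℝ, E).prod 𝓘(ℝ, E))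
      (fun q ↦ TotalSpace.mk' E (E := fun q : M ↦ TangentSpace 𝓘(ℝ, E) q) q (X q)) p :=
  ContMDiff.mdifferentiable hX (by simp) p

theorem SmoothField.smul {X : VField E M} (hX : SmoothField X) {f : M → ℝ}
    (hf : ContMDiff 𝓘(ℝ, E) 𝓘(ℝ, ℝ) ∞ f) : SmoothField (f • X) :=
  ContMDiff.smul_section hf hX

variable (E M) in
/-- The real vector space of smooth vector fields. -/
def smoothFields : Submodule ℝ (VField E M) where
  carrier := {X | SmoothField X}
  add_mem' hX hY := ContMDiff.add_section hX hY
  zero_mem' := contMDiff_zeroSection ℝ _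
  smul_mem' _ _ hX := ContMDiff.const_smul_section hX

theorem SmoothEndo.smoothField {J : ∀ p : M, TangentSpace 𝓘(ℝ, E) p →L[ℝ] TangentSpace 𝓘(ℝ, E) p}
    (hJ : SmoothEndo J) {X : VField E M} (hX : SmoothField X) :
    SmoothField (fun q ↦ J q (X q)) :=
  ContMDiff.clm_bundle_apply (F₁ := E) (F₂ := E) hJ hX

theorem SmoothTensor12.smoothField {S : ∀ p : M, TangentSpace 𝓘(ℝ, E) p →L[ℝ]
      TangentSpace 𝓘(ℝ, E) p →L[ℝ] TangentSpace 𝓘(ℝ, E) p}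
    (hS : SmoothTensor12 S) {X Y : VField E M} (hX : SmoothField X) (hY : SmoothField Y) :
    SmoothField (fun q ↦ S q (X q) (Y q)) :=
  ContMDiff.clm_bundle_apply₂ (F₁ := E) (F₂ := E) (F₃ := E) hS hX hY

theorem PseudoRiemannianMetric.contMDiff_apply (g : PseudoRiemannianMetric E M)
    {X Y : VField E M} (hX : SmoothField X) (hY : SmoothField Y) :
    ContMDiff 𝓘(ℝ, E) 𝓘(ℝ, ℝ) ∞ (fun q ↦ g.val q (X q) (Y q)) := by
  intro x
  have : ContMDiffAt 𝓘(ℝ, E) (𝓘(ℝ, E).prod 𝓘(ℝ)) ∞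
      (fun m ↦ TotalSpace.mk' ℝ (E := Bundle.Trivial M ℝ) m (g.val m (X m) (Y m))) x := by
    apply ContMDiffAt.clm_bundle_apply₂ (F₁ := E) (F₂ := E)
    · exact g.smooth x
    · exact hX x
    · exact hY x
  simp only [contMDiffAt_totalSpace] at this
  exact this.2

/-- A connection is smooth if it preserves smoothness of vector fields. -/
def SmoothConnection (D : Connection E M) : Prop :=
  ∀ X Y : VField E M, SmoothField X → SmoothField Y → SmoothField (along D X Y)

theorem IsLeviCivita.smoothConnection {g : PseudoRiemannianMetric E M} {D : Connection E M}
    (hD : IsLeviCivita g D) : SmoothConnection D := by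
  intro X Y hX hY
  have h := hD.smooth.contMDiff.contMDiff (σ := Y) (ContMDiff.contMDiffOn hY)
  rw [contMDiffOn_univ] at h
  exact ContMDiff.clm_bundle_apply (F₁ := E) (F₂ := E) h hX

theorem SmoothConnection.subTensor {D : Connection E M} (hD : SmoothConnection D)
    {S : ∀ p : M, TangentSpace 𝓘(ℝ, E) p →L[ℝ]
      TangentSpace 𝓘(ℝ, E) p →L[ℝ] TangentSpace 𝓘(ℝ, E) p} (hS : SmoothTensor12 S) :
    SmoothConnection (subTensor D S) := by
  intro X Y hX hY
  have : along (EpsKahler.subTensor D S) X Y = along D X Y - fun q ↦ S q (X q) (Y q) := by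
    funext p
    exact along_subTensor D S X Y p
  rw [this]
  exact ContMDiff.sub_section (hD X Y hX hY) (hS.smoothField hX hY)

theorem along_add_right (D : Connection E M) {X Y Z : VField E M}
    (hY : SmoothField Y) (hZ : SmoothField Z) :
    along D X (Y + Z) = along D X Y + along D X Z := by
  funext p
  have := D.isCovariantDerivativeOnUniv.add (hY.mdifferentiableAt p) (hZ.mdifferentiableAt p)
  simp only [along, this, Pi.add_apply]
  rfl

theorem along_smul_right (D : Connection E M) {X Y : VField E M} (c : ℝ)
    (hY : SmoothField Y) :
    along D X (c • Y) = c • along D X Y := by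
  funext p
  have := D.isCovariantDerivativeOnUniv.smul_const c (hY.mdifferentiableAt p)
  simp only [along, this, Pi.smul_apply]
  rfl

theorem along_funSMul (D : Connection E M) {X Y : VField E M} {f : M → ℝ}
    (hf : ContMDiff 𝓘(ℝ, E) 𝓘(ℝ, ℝ) ∞ f) (hY : SmoothField Y) (p : M) :
    along D X (f • Y) p = f p • along D X Y p +
      mvfderiv 𝓘(ℝ, E) f p (X p) • Y p := by
  have := D.isCovariantDerivativeOnUniv.leibniz (hY.mdifferentiableAt p)
    (hf.mdifferentiable (by simp) p)
  simp only [along, this]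
  rfl

theorem along_congr (D : Connection E M) {X X' Y Y' : VField E M} (hY : SmoothField Y) {p : M}
    (hX : X' p = X p) (h : Y' =ᶠ[𝓝 p] Y) : along D X' Y' p = along D X Y p := by
  have hm : MDifferentiableAt 𝓘(ℝ, E) (𝓘(ℝ, E).prod 𝓘(ℝ, E))
      (fun q ↦ TotalSpace.mk' E (E := fun q : M ↦ TangentSpace 𝓘(ℝ, E) q) q (Y' q)) p := by
    refine (hY.mdifferentiableAt p).congr_of_eventuallyEq ?_
    filter_upwards [h] with q hq
    rw [hq]
  have := D.isCovariantDerivativeOnUniv.congr_of_eventuallyEq hm (hY.mdifferentiableAt p)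
    Filter.univ_mem h
  simp only [along, this, hX]

/-- The curvature at `p` sees only germs at `p`, so the local extensions in `curvatureAt` may be
replaced by globally smooth ones. -/
theorem curvature_congr {D : Connection E M} (hD : SmoothConnection D)
    {X X' Y Y' Z Z' : VField E M} (hX : SmoothField X) (hY : SmoothField Y) (hZ : SmoothField Z)
    {p : M} (hXX : X' =ᶠ[𝓝 p] X) (hYY : Y' =ᶠ[𝓝 p] Y) (hZZ : Z' =ᶠ[𝓝 p] Z) :
    curvature D X' Y' Z' p = curvature D X Y Z p := by
  have key : ∀ {V V' : VField E M}, V' =ᶠ[𝓝 p] V → along D V' Z' =ᶠ[𝓝 p] along D V Z := by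
    intro V V' hV
    filter_upwards [hV, hZZ.eventuallyEq_nhds] with q hq hZq
    exact along_congr D hZ hq hZq
  simp only [curvature]
  rw [along_congr D hZ (hXX.mlieBracket_vectorField_eq hYY) hZZ,
    along_congr D (hD Y Z hY hZ) hXX.self_of_nhds (key hYY),
    along_congr D (hD X Z hX hZ) hYY.self_of_nhds (key hXX)]

section Extension

variable [FiniteDimensional ℝ E]

variable (E) in
/-- The tangent vector at `p` with the same coordinates, in the chart centred at `p`, as a tangent
vector at a nearby point `q`: the linear form of `FiberBundle.extend`. -/
noncomputable def extendAt (p q : M) : TangentSpace 𝓘(ℝ, E) p →ₗ[ℝ] TangentSpace 𝓘(ℝ, E) q :=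
  (trivializationAt E (TangentSpace 𝓘(ℝ, E)) p).symmₗ ℝ q ∘ₗ
    (trivializationAt E (TangentSpace 𝓘(ℝ, E)) p).linearMapAt ℝ p

omit [FiniteDimensional ℝ E] in
theorem extendAt_apply {p q : M}
    (hq : q ∈ (trivializationAt E (TangentSpace 𝓘(ℝ, E) : M → Type _) p).baseSet)
    (v : TangentSpace 𝓘(ℝ, E) p) : extendAt E p q v = FiberBundle.extend E v q := by
  have hp := FiberBundle.mem_baseSet_trivializationAt E (TangentSpace 𝓘(ℝ, E)) p
  refine (Trivialization.symmₗ_apply _ hq _).trans ?_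
  have := congr_fun (Trivialization.coe_linearMapAt_of_mem (R := ℝ) _ hp) v
  exact congr_arg _ this

/-- A globally defined smooth vector field with a given value at `p`: the local extension
`FiberBundle.extend`, cut off by a bump function. -/
noncomputable def globalExtend (p : M) (v : TangentSpace 𝓘(ℝ, E) p) : VField E M := fun q ↦
  (Classical.arbitrary (SmoothBumpFunction 𝓘(ℝ, E) p) : SmoothBumpFunction 𝓘(ℝ, E) p) q •
    extendAt E p q v

theorem smoothField_globalExtend [T2Space M] (p : M) (v : TangentSpace 𝓘(ℝ, E) p) :
    SmoothField (globalExtend p v) := by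
  set t := trivializationAt E (TangentSpace 𝓘(ℝ, E)) p
  refine ContMDiffOn.smul_section_of_tsupport (u := t.baseSet) (s := fun q ↦ extendAt E p q v)
    (SmoothBumpFunction.contMDiff _).contMDiffOn t.open_baseSet ?_ ?_
  · exact SmoothBumpFunction.tsupport_subset_chartAt_source _
  · intro x hx
    rw [t.contMDiffWithinAt_section _ hx]
    have : ContMDiffOn 𝓘(ℝ, E) 𝓘(ℝ, E) ∞ (fun _ : M ↦ (t ⟨p, v⟩).2) t.baseSet := contMDiffOn_const
    refine this.congr (fun x hx ↦ ?_) x hx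
    rw [extendAt_apply hx]
    have := congr_arg Prod.snd (t.apply_mk_symm hx (t ⟨p, v⟩).2)
    exact this

theorem globalExtend_eventuallyEq (p : M) (v : TangentSpace 𝓘(ℝ, E) p) :
    globalExtend p v =ᶠ[𝓝 p] (FiberBundle.extend E v : VField E M) := by
  filter_upwards [(Classical.arbitrary (SmoothBumpFunction 𝓘(ℝ, E) p)).eventuallyEq_one,
    (trivializationAt E (TangentSpace 𝓘(ℝ, E)) p).open_baseSet.mem_nhds
      (FiberBundle.mem_baseSet_trivializationAt E (TangentSpace 𝓘(ℝ, E)) p)] with q hq hq'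
  rw [← extendAt_apply hq' v]
  simp [globalExtend, hq]
  rfl

@[simp]
theorem globalExtend_apply_self (p : M) (v : TangentSpace 𝓘(ℝ, E) p) :
    globalExtend p v p = v := by
  rw [(globalExtend_eventuallyEq p v).self_of_nhds]
  simp

variable [T2Space M]

variable (E) in
/-- Extension of tangent vectors at `p` to globally defined smooth vector fields. -/
noncomputable def extendLinear (p : M) : TangentSpace 𝓘(ℝ, E) p →ₗ[ℝ] smoothFields E M where
  toFun v := ⟨globalExtend p v, smoothField_globalExtend p v⟩
  map_add' v w := by
    apply Subtype.ext
    funext q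
    simp [globalExtend]
  map_smul' c v := by
    apply Subtype.ext
    funext q
    simp [globalExtend, smul_comm c]

theorem curvatureAt_eq {D : Connection E M} (hD : SmoothConnection D) (p : M)
    (u v w : TangentSpace 𝓘(ℝ, E) p) :
    curvatureAt D p u v w =
      curvature D (extendLinear E p u) (extendLinear E p v) (extendLinear E p w) p :=
  curvature_congr hD (smoothField_globalExtend p u) (smoothField_globalExtend p v)
    (smoothField_globalExtend p w) (globalExtend_eventuallyEq p u).symm
    (globalExtend_eventuallyEq p v).symm (globalExtend_eventuallyEq p w).symm

end Extension

end SmoothFields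

/-! ### Formal curvature identities for bilinear operations on a space of fields -/

section AbstractConnections

variable {𝔛 : Type*} [AddCommGroup 𝔛] [Module ℝ 𝔛]

/-- The curvature operator of the connection `N'` on a space `𝔛` of vector fields whose Lie bracket
is `N X Y - N Y X`. -/
def relCurvature (N N' : 𝔛 →ₗ[ℝ] 𝔛 →ₗ[ℝ] 𝔛) (X Y : 𝔛) : 𝔛 →ₗ[ℝ] 𝔛 :=
  N' (N X Y - N Y X) - (N' X ∘ₗ N' Y - N' Y ∘ₗ N' X)

/-- The curvature of a torsion-free connection, as a trilinear map. -/
def curvatureMap (N : 𝔛 →ₗ[ℝ] 𝔛 →ₗ[ℝ] 𝔛) : 𝔛 →ₗ[ℝ] 𝔛 →ₗ[ℝ] 𝔛 →ₗ[ℝ] 𝔛 :=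
  LinearMap.mk₂ ℝ (relCurvature N N)
    (fun X X' Y ↦ by ext Z; simp [relCurvature]; abel)
    (fun c X Y ↦ by ext Z; simp [relCurvature]; module)
    (fun X Y Y' ↦ by ext Z; simp [relCurvature]; abel)
    (fun c X Y ↦ by ext Z; simp [relCurvature]; module)

theorem relCurvature_apply (N N' : 𝔛 →ₗ[ℝ] 𝔛 →ₗ[ℝ] 𝔛) (X Y Z : 𝔛) :
    relCurvature N N' X Y Z = N' (N X Y - N Y X) Z - (N' X (N' Y Z) - N' Y (N' X Z)) := rfl

theorem curvatureMap_apply (N : 𝔛 →ₗ[ℝ] 𝔛 →ₗ[ℝ] 𝔛) (X Y Z : 𝔛) :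
    curvatureMap N X Y Z = N (N X Y - N Y X) Z - (N X (N Y Z) - N Y (N X Z)) := rfl

theorem curvatureMap_swap (N : 𝔛 →ₗ[ℝ] 𝔛 →ₗ[ℝ] 𝔛) (X Y Z : 𝔛) :
    curvatureMap N X Y Z = -curvatureMap N Y X Z := by
  simp only [curvatureMap_apply, map_sub, LinearMap.sub_apply]
  abel

/-- The Jacobi identity for the bracket `N X Y - N Y X`. -/
def SatisfiesJacobi (N : 𝔛 →ₗ[ℝ] 𝔛 →ₗ[ℝ] 𝔛) : Prop :=
  ∀ X Y Z : 𝔛, N X (N Y Z - N Z Y) - N (N Y Z - N Z Y) X =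
    (N (N X Y - N Y X) Z - N Z (N X Y - N Y X)) + (N Y (N X Z - N Z X) - N (N X Z - N Z X) Y)

theorem curvatureMap_bianchi {N : 𝔛 →ₗ[ℝ] 𝔛 →ₗ[ℝ] 𝔛} (hN : SatisfiesJacobi N) (X Y Z : 𝔛) :
    curvatureMap N X Y Z + curvatureMap N Y Z X + curvatureMap N Z X Y = 0 := by
  rw [← neg_eq_zero, ← sub_eq_zero.2 (hN X Y Z)]
  simp only [curvatureMap_apply, map_sub, LinearMap.sub_apply]
  abel

/-- After expansion everything cancels except `N` along the Jacobi expression of `X, Y, Z`, applied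
to `W`. -/
theorem curvatureMap_bianchi_deriv {N : 𝔛 →ₗ[ℝ] 𝔛 →ₗ[ℝ] 𝔛} (hN : SatisfiesJacobi N)
    (X Y Z W : 𝔛) :
    (N X (curvatureMap N Y Z W) - curvatureMap N (N X Y) Z W - curvatureMap N Y (N X Z) W
        - curvatureMap N Y Z (N X W))
      + (N Y (curvatureMap N Z X W) - curvatureMap N (N Y Z) X W - curvatureMap N Z (N Y X) W
        - curvatureMap N Z X (N Y W))
      + (N Z (curvatureMap N X Y W) - curvatureMap N (N Z X) Y W - curvatureMap N X (N Z Y) W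
        - curvatureMap N X Y (N Z W)) = 0 := by
  have h : N ((N X (N Y Z - N Z Y) - N (N Y Z - N Z Y) X) -
    ((N (N X Y - N Y X) Z - N Z (N X Y - N Y X)) + (N Y (N X Z - N Z X) - N (N X Z - N Z X) Y))) W
      = 0 := by
    rw [sub_eq_zero.2 (hN X Y Z)]
    simp
  rw [← h]
  simp only [curvatureMap_apply, map_sub, map_add, LinearMap.sub_apply, LinearMap.add_apply]
  abel

/-- Terms that differentiate `T` cancel because `T` is `N'`-parallel. What survives is the
commutator of `T X` and `T Y`, and `T` along the part `T X Y - T Y X` of the bracket. -/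
theorem curvatureMap_eq_relCurvature_add {N N' T : 𝔛 →ₗ[ℝ] 𝔛 →ₗ[ℝ] 𝔛}
    (hNT : ∀ X Y, N X Y = N' X Y + T X Y)
    (hT : ∀ X Y Z, N' X (T Y Z) = T (N' X Y) Z + T Y (N' X Z)) (X Y Z : 𝔛) :
    curvatureMap N X Y Z = relCurvature N N' X Y Z +
      (T (T X Y - T Y X) Z - (T X (T Y Z) - T Y (T X Z))) := by
  simp only [curvatureMap_apply, relCurvature_apply, hNT, map_sub, map_add, LinearMap.sub_apply,
    LinearMap.add_apply, hT]
  abel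

/-- Each `N' X` is a derivation annihilating `R`, hence so are commutators of these and `N'` along
the bracket. -/
theorem relCurvature_apply_of_parallel {N N' : 𝔛 →ₗ[ℝ] 𝔛 →ₗ[ℝ] 𝔛}
    {R : 𝔛 →ₗ[ℝ] 𝔛 →ₗ[ℝ] 𝔛 →ₗ[ℝ] 𝔛}
    (hR : ∀ X Y Z W, N' X (R Y Z W) = R (N' X Y) Z W + R Y (N' X Z) W + R Y Z (N' X W))
    (X Y A B C : 𝔛) :
    relCurvature N N' X Y (R A B C) = R (relCurvature N N' X Y A) B C +
      R A (relCurvature N N' X Y B) C + R A B (relCurvature N N' X Y C) := by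
  simp only [relCurvature_apply, map_sub, map_add, LinearMap.sub_apply, hR]
  abel

end AbstractConnections

/-! ### Brackets acting on functions, and skewness of the curvature of a metric connection -/

section FieldAlgebra

open Topology Filter VectorField

variable {E : Type*} [NormedAddCommGroup E] [NormedSpace ℝ E] [FiniteDimensional ℝ E]
  {M : Type*} [TopologicalSpace M] [ChartedSpace E M] [IsManifold 𝓘(ℝ, E) ∞ M]

omit [FiniteDimensional ℝ E] in
theorem IsLeviCivita.mlieBracket_eq {g : PseudoRiemannianMetric E M} {D : Connection E M}
    (hD : IsLeviCivita g D) {X Y : VField E M} (hX : SmoothField X) (hY : SmoothField Y) :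
    mlieBracket 𝓘(ℝ, E) X Y = along D X Y - along D Y X := by
  funext p
  exact (hD.torsion_free X Y hX hY p).symm

/-- A smooth connection, as a bilinear operation on smooth vector fields. -/
noncomputable def connMap {D : Connection E M} (hD : SmoothConnection D) :
    smoothFields E M →ₗ[ℝ] smoothFields E M →ₗ[ℝ] smoothFields E M :=
  LinearMap.mk₂ ℝ (fun X Y ↦ ⟨along D X Y, hD X Y X.2 Y.2⟩)
    (fun X X' Y ↦ by
      apply Subtype.ext
      funext p
      exact map_add (D Y p) _ _)
    (fun c X Y ↦ by
      apply Subtype.ext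
      funext p
      exact map_smul (D Y p) _ _)
    (fun X Y Y' ↦ Subtype.ext (along_add_right D Y.2 Y'.2))
    (fun c X Y ↦ Subtype.ext (along_smul_right D c Y.2))

theorem smoothField_mlieBracket {X Y : VField E M} (hX : SmoothField X) (hY : SmoothField Y) :
    SmoothField (mlieBracket 𝓘(ℝ, E) X Y) := by
  have := FiniteDimensional.complete ℝ E
  have : IsManifold 𝓘(ℝ, E) (minSmoothness ℝ 2) M :=
    IsManifold.of_le (n := ∞) (by simpa using ENat.LEInfty.out)
  have : IsManifold 𝓘(ℝ, E) (((⊤ : ℕ∞) : WithTop ℕ∞) + 1) M := ‹IsManifold 𝓘(ℝ, E) ∞ M›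
  exact ContDiff.mlieBracket_vectorField (n := ⊤) (m := ⊤) hX hY (by simp)

/-- The Lie bracket of vector fields acts on functions as the commutator. -/
theorem mvfderiv_mlieBracket_apply [T2Space M] [Nontrivial E] {X Y : VField E M}
    (hX : SmoothField X) (hY : SmoothField Y) {f fX fY : M → ℝ}
    (hf : ContMDiff 𝓘(ℝ, E) 𝓘(ℝ, ℝ) ∞ f) (hfX : ContMDiff 𝓘(ℝ, E) 𝓘(ℝ, ℝ) ∞ fX)
    (hfY : ContMDiff 𝓘(ℝ, E) 𝓘(ℝ, ℝ) ∞ fY)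
    (hXf : ∀ q, mvfderiv 𝓘(ℝ, E) f q (X q) = fX q)
    (hYf : ∀ q, mvfderiv 𝓘(ℝ, E) f q (Y q) = fY q) (p : M) :
    mvfderiv 𝓘(ℝ, E) f p (mlieBracket 𝓘(ℝ, E) X Y p) =
      mvfderiv 𝓘(ℝ, E) fY p (X p) - mvfderiv 𝓘(ℝ, E) fX p (Y p) := by
  have := FiniteDimensional.complete ℝ E
  -- The Jacobi identity for `X, Y, f • Z` minus `f` times that for `X, Y, Z` leaves the desired
  -- scalar identity multiplied by `Z p`, so any `Z` with `Z p ≠ 0` serves.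
  obtain ⟨v, hv⟩ : ∃ v : TangentSpace 𝓘(ℝ, E) p, v ≠ 0 := exists_ne (0 : E)
  set Z : VField E M := globalExtend p v
  have hZ : SmoothField Z := smoothField_globalExtend p v
  have hZp : Z p = v := globalExtend_apply_self p v
  have md : ∀ {h : M → ℝ}, ContMDiff 𝓘(ℝ, E) 𝓘(ℝ, ℝ) ∞ h → ∀ q,
    MDifferentiableAt 𝓘(ℝ, E) 𝓘(ℝ, ℝ) h q := fun h q ↦ h.mdifferentiable (by simp) q
  have bY : mlieBracket 𝓘(ℝ, E) Y (f • Z) = fY • Z + f • mlieBracket 𝓘(ℝ, E) Y Z := by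
    funext q
    rw [mlieBracket_smul_right (md hf q) (hZ.mdifferentiableAt q), hYf]
    rfl
  have bX : mlieBracket 𝓘(ℝ, E) X (f • Z) = fX • Z + f • mlieBracket 𝓘(ℝ, E) X Z := by
    funext q
    rw [mlieBracket_smul_right (md hf q) (hZ.mdifferentiableAt q), hXf]
    rfl
  have hYZ := smoothField_mlieBracket hY hZ
  have hXZ := smoothField_mlieBracket hX hZ
  have two : ∀ {V : VField E M}, SmoothField V → ContMDiffAt 𝓘(ℝ, E) (𝓘(ℝ, E).prod 𝓘(ℝ, E))
      (minSmoothness ℝ 2) (fun q ↦ TotalSpace.mk' E (E := fun q : M ↦ TangentSpace 𝓘(ℝ, E) q)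
        q (V q)) p := fun hV ↦ (hV p).of_le (by simpa using ENat.LEInfty.out)
  have : IsManifold 𝓘(ℝ, E) (minSmoothness ℝ 3) M :=
    IsManifold.of_le (n := ∞) (by simpa using ENat.LEInfty.out)
  have jac1 := leibniz_identity_mlieBracket_apply (I := 𝓘(ℝ, E)) (U := X) (V := Y) (W := f • Z)
    (x := p) (two hX) (two hY) (two (hZ.smul hf))
  have jac2 := leibniz_identity_mlieBracket_apply (I := 𝓘(ℝ, E)) (U := X) (V := Y) (W := Z)
    (x := p) (two hX) (two hY) (two hZ)
  rw [bX, bY, mlieBracket_add_right ((hZ.smul hfY).mdifferentiableAt p)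
    ((hYZ.smul hf).mdifferentiableAt p), mlieBracket_add_right ((hZ.smul hfX).mdifferentiableAt p)
    ((hXZ.smul hf).mdifferentiableAt p), mlieBracket_smul_right (md hfY p) (hZ.mdifferentiableAt p),
    mlieBracket_smul_right (md hfX p) (hZ.mdifferentiableAt p),
    mlieBracket_smul_right (md hf p) (hYZ.mdifferentiableAt p),
    mlieBracket_smul_right (md hf p) (hXZ.mdifferentiableAt p),
    mlieBracket_smul_right (md hf p) (hZ.mdifferentiableAt p), jac2, hXf, hYf, hZp] at jac1
  have h0 : (mvfderiv 𝓘(ℝ, E) f p (mlieBracket 𝓘(ℝ, E) X Y p) -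
      (mvfderiv 𝓘(ℝ, E) fY p (X p) - mvfderiv 𝓘(ℝ, E) fX p (Y p))) •
      v = 0 := by
    rw [← sub_eq_zero] at jac1
    rw [← neg_eq_zero, ← jac1]
    module
  rcases smul_eq_zero.1 h0 with h | h
  · exact sub_eq_zero.1 h
  · exact absurd h hv

omit [FiniteDimensional ℝ E] in
theorem ParallelMetric.mvfderiv_apply {D : Connection E M} {g : PseudoRiemannianMetric E M}
    (h : ParallelMetric D g) {X Y Z : VField E M} (hX : SmoothField X) (hY : SmoothField Y)
    (hZ : SmoothField Z) (p : M) :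
    mvfderiv 𝓘(ℝ, E) (fun q ↦ g.val q (Y q) (Z q)) p (X p) =
      g.val p (along D X Y p) (Z p) + g.val p (Y p) (along D X Z p) :=
  h X Y Z hX hY hZ p

omit [FiniteDimensional ℝ E] in
theorem ParallelMetric.mvfderiv_mvfderiv_apply {D : Connection E M} {g : PseudoRiemannianMetric E M}
    (h : ParallelMetric D g) (hD : SmoothConnection D) {X Y Z W : VField E M}
    (hX : SmoothField X) (hY : SmoothField Y) (hZ : SmoothField Z) (hW : SmoothField W) (p : M) :
    mvfderiv 𝓘(ℝ, E) (fun q ↦ g.val q (along D Y Z q) (W q) + g.val q (Z q) (along D Y W q))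
        p (X p) =
      (g.val p (along D X (along D Y Z) p) (W p) + g.val p (along D Y Z p) (along D X W p)) +
      (g.val p (along D X Z p) (along D Y W p) + g.val p (Z p) (along D X (along D Y W) p)) := by
  have h1 := g.contMDiff_apply (hD Y Z hY hZ) hW
  have h2 := g.contMDiff_apply hZ (hD Y W hY hW)
  have := mvfderiv_add (h1.mdifferentiable (by simp) p) (h2.mdifferentiable (by simp) p)
  rw [← h.mvfderiv_apply hX (hD Y Z hY hZ) hW, ← h.mvfderiv_apply hX hZ (hD Y W hY hW)]
  exact congr_arg (fun A ↦ A (X p)) this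

/-- The bracket acts on the function `g(Z, W)` as the commutator of `X` and `Y`. Expanding both
sides by `D g = 0`, the mixed first-order terms cancel. -/
theorem curvature_metric [T2Space M] [Nontrivial E] {g : PseudoRiemannianMetric E M}
    {D : Connection E M} (h : ParallelMetric D g) (hD : SmoothConnection D)
    {X Y Z W : VField E M} (hX : SmoothField X) (hY : SmoothField Y)
    (hZ : SmoothField Z) (hW : SmoothField W) (p : M) :
    g.val p (curvature D X Y Z p) (W p) = -g.val p (Z p) (curvature D X Y W p) := by
  have key := mvfderiv_mlieBracket_apply hX hY (g.contMDiff_apply hZ hW)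
    ((g.contMDiff_apply (hD X Z hX hZ) hW).add (g.contMDiff_apply hZ (hD X W hX hW)))
    ((g.contMDiff_apply (hD Y Z hY hZ) hW).add (g.contMDiff_apply hZ (hD Y W hY hW)))
    (h.mvfderiv_apply hX hZ hW) (h.mvfderiv_apply hY hZ hW) p
  rw [h.mvfderiv_apply (smoothField_mlieBracket hX hY) hZ hW] at key
  have k1 := h.mvfderiv_mvfderiv_apply hD hX hY hZ hW p
  have k2 := h.mvfderiv_mvfderiv_apply hD hY hX hZ hW p
  have key' := key.trans (congr_arg₂ (· - ·) k1 k2)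
  simp only [curvature, map_sub, sub_apply]
  linarith

end FieldAlgebra

/-! ### Tensoriality: the curvature as a trilinear map at a point -/

section CurvatureTensor

open Topology Filter VectorField

variable {E : Type*} [NormedAddCommGroup E] [NormedSpace ℝ E] [FiniteDimensional ℝ E]
  {M : Type*} [TopologicalSpace M] [ChartedSpace E M] [IsManifold 𝓘(ℝ, E) ∞ M]
  {g : PseudoRiemannianMetric E M} {D : Connection E M}

omit [FiniteDimensional ℝ E] in
theorem IsLeviCivita.mdifferentiableAt_along (hD : IsLeviCivita g D) {X Y : VField E M}
    (hY : SmoothField Y) {p : M}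
    (hX : MDifferentiableAt 𝓘(ℝ, E) (𝓘(ℝ, E).prod 𝓘(ℝ, E))
      (fun q ↦ TotalSpace.mk' E (E := fun q : M ↦ TangentSpace 𝓘(ℝ, E) q) q (X q)) p) :
    MDifferentiableAt 𝓘(ℝ, E) (𝓘(ℝ, E).prod 𝓘(ℝ, E))
      (fun q ↦ TotalSpace.mk' E (E := fun q : M ↦ TangentSpace 𝓘(ℝ, E) q) q (along D X Y q)) p := by
  have h := hD.smooth.contMDiff.contMDiff (σ := Y) (ContMDiff.contMDiffOn hY)
  rw [contMDiffOn_univ] at h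
  exact MDifferentiableAt.clm_bundle_apply (F₁ := E) (F₂ := E) (h.mdifferentiable (by simp) p) hX

theorem tensorialAt_curvature_left (hD : IsLeviCivita g D) (Y : VField E M)
    {Z : VField E M} (hZ : SmoothField Z) (p : M) :
    TensorialAt 𝓘(ℝ, E) E (fun X : VField E M ↦ curvature D X Y Z p) p where
  smul {f X} hf hX := by
    have := FiniteDimensional.complete ℝ E
    have h1 : along D (f • X) Z = f • along D X Z := by
      funext q
      exact map_smul (D Z q) _ _
    have h2 := D.isCovariantDerivativeOnUniv.leibniz (hD.mdifferentiableAt_along hZ hX) hf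
    simp only [curvature, h1]
    simp only [along] at h2 ⊢
    rw [mlieBracket_smul_left hf hX, h2]
    simp
    module
  add {X X'} hX hX' := by
    have := FiniteDimensional.complete ℝ E
    have h1 : along D (X + X') Z = along D X Z + along D X' Z := by
      funext q
      exact map_add (D Z q) _ _
    have h2 := D.isCovariantDerivativeOnUniv.add (hD.mdifferentiableAt_along hZ hX)
      (hD.mdifferentiableAt_along hZ hX')
    simp only [curvature, h1]
    simp only [along] at h2 ⊢
    rw [mlieBracket_add_left hX hX', h2]
    simp
    abel

theorem curvature_congr_left (hD : IsLeviCivita g D) {X X' Y Z : VField E M}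
    (hX : SmoothField X) (hX' : SmoothField X') (hZ : SmoothField Z) {p : M}
    (h : X p = X' p) : curvature D X Y Z p = curvature D X' Y Z p :=
  (tensorialAt_curvature_left hD Y hZ p).pointwise (hX.mdifferentiableAt p)
    (hX'.mdifferentiableAt p) h

omit [FiniteDimensional ℝ E] in
theorem curvature_swap (D : Connection E M) (X Y Z : VField E M) (p : M) :
    curvature D X Y Z p = -curvature D Y X Z p := by
  simp only [curvature]
  rw [mlieBracket_swap]
  simp [along]
  abel

/-- By skewness `g(R_{XY} Z, W) = -g(Z, R_{XY} W)`, and the right-hand side involves only the value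
`Z p`; nondegeneracy concludes. -/
theorem curvature_congr_right [T2Space M] [Nontrivial E] (hD : IsLeviCivita g D)
    {X Y Z Z' : VField E M} (hX : SmoothField X) (hY : SmoothField Y) (hZ : SmoothField Z)
    (hZ' : SmoothField Z') {p : M}
    (h : Z p = Z' p) : curvature D X Y Z p = curvature D X Y Z' p := by
  rw [← sub_eq_zero]
  refine g.nondegenerate p _ fun w ↦ ?_
  have hW := smoothField_globalExtend p w
  have h1 := curvature_metric hD.metric hD.smoothConnection hX hY hZ hW p
  have h2 := curvature_metric hD.metric hD.smoothConnection hX hY hZ' hW p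
  rw [globalExtend_apply_self, h] at h1
  rw [globalExtend_apply_self] at h2
  rw [map_sub, sub_apply, h1, h2, sub_self]

theorem curvature_tensorial [T2Space M] [Nontrivial E] (hD : IsLeviCivita g D)
    {X X' Y Y' Z Z' : VField E M} (hX : SmoothField X) (hX' : SmoothField X') (hY : SmoothField Y)
    (hY' : SmoothField Y') (hZ : SmoothField Z) (hZ' : SmoothField Z') {p : M}
    (hXX : X p = X' p) (hYY : Y p = Y' p) (hZZ : Z p = Z' p) :
    curvature D X Y Z p = curvature D X' Y' Z' p := by
  rw [curvature_congr_left hD hX hX' hZ hXX, curvature_swap,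
    curvature_congr_left hD hY hY' hZ hYY, ← curvature_swap,
    curvature_congr_right hD hX' hY' hZ hZ' hZZ]

omit [FiniteDimensional ℝ E] in
@[simp]
theorem coe_connMap (hD : SmoothConnection D) (X Y : smoothFields E M) :
    (connMap hD X Y : VField E M) = along D X Y := rfl

omit [FiniteDimensional ℝ E] in
theorem coe_curvatureMap (hD : IsLeviCivita g D) (X Y Z : smoothFields E M) :
    (curvatureMap (connMap hD.smoothConnection) X Y Z : VField E M) = curvature D X Y Z := by
  funext p
  simp only [curvature]
  rw [hD.mlieBracket_eq X.2 Y.2]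
  rfl

theorem satisfiesJacobi_connMap (hD : IsLeviCivita g D) :
    SatisfiesJacobi (connMap hD.smoothConnection) := by
  intro X Y Z
  have := FiniteDimensional.complete ℝ E
  have : IsManifold 𝓘(ℝ, E) (minSmoothness ℝ 3) M :=
    IsManifold.of_le (n := ∞) (by simpa using ENat.LEInfty.out)
  have two : ∀ V : smoothFields E M, ContMDiff 𝓘(ℝ, E) (𝓘(ℝ, E).prod 𝓘(ℝ, E))
      (minSmoothness ℝ 2) (fun q ↦ TotalSpace.mk' E (E := fun q : M ↦ TangentSpace 𝓘(ℝ, E) q)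
        q ((V : VField E M) q)) := fun V ↦ V.2.of_le (by simpa using ENat.LEInfty.out)
  have key := leibniz_identity_mlieBracket (I := 𝓘(ℝ, E)) (two X) (two Y) (two Z)
  have hb : ∀ U V : smoothFields E M, mlieBracket 𝓘(ℝ, E) (U : VField E M) V =
      (connMap hD.smoothConnection U V - connMap hD.smoothConnection V U : smoothFields E M) :=
    fun U V ↦ hD.mlieBracket_eq U.2 V.2
  simp only [hb] at key
  exact Subtype.ext key

/-- Evaluation of smooth vector fields at a point. -/
def evalAt (p : M) : smoothFields E M →ₗ[ℝ] TangentSpace 𝓘(ℝ, E) p where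
  toFun X := (X : VField E M) p
  map_add' _ _ := rfl
  map_smul' _ _ := rfl

variable [T2Space M]

@[simp]
theorem evalAt_extendLinear (p : M) (v : TangentSpace 𝓘(ℝ, E) p) :
    evalAt p (extendLinear E p v) = v :=
  globalExtend_apply_self p v

/-- The curvature tensor at a point, as a trilinear map. -/
noncomputable def curvatureTensor (hD : IsLeviCivita g D) (p : M) :
    TangentSpace 𝓘(ℝ, E) p →ₗ[ℝ] TangentSpace 𝓘(ℝ, E) p →ₗ[ℝ] TangentSpace 𝓘(ℝ, E) p →ₗ[ℝ]
      TangentSpace 𝓘(ℝ, E) p :=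
  LinearMap.mk₂ ℝ
    (fun u v ↦ evalAt p ∘ₗ (curvatureMap (connMap hD.smoothConnection) (extendLinear E p u)
      (extendLinear E p v)) ∘ₗ extendLinear E p)
    (fun _ _ _ ↦ by ext; simp) (fun _ _ _ ↦ by ext; simp)
    (fun _ _ _ ↦ by ext; simp) (fun _ _ _ ↦ by ext; simp)

theorem curvatureAt_eq_curvatureTensor (hD : IsLeviCivita g D) (p : M)
    (u v w : TangentSpace 𝓘(ℝ, E) p) : curvatureAt D p u v w = curvatureTensor hD p u v w := by
  rw [curvatureAt_eq hD.smoothConnection, ← coe_curvatureMap hD]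
  rfl

theorem evalAt_curvatureMap [Nontrivial E] (hD : IsLeviCivita g D) (p : M)
    (X Y Z : smoothFields E M) :
    evalAt p (curvatureMap (connMap hD.smoothConnection) X Y Z) =
      curvatureTensor hD p (evalAt p X) (evalAt p Y) (evalAt p Z) := by
  have h1 : evalAt p (curvatureMap (connMap hD.smoothConnection) X Y Z) = curvature D X Y Z p := by
    rw [← coe_curvatureMap hD]
    rfl
  have h2 : ∀ u v w, curvatureTensor hD p u v w =
      curvature D (extendLinear E p u) (extendLinear E p v) (extendLinear E p w) p := by
    intro u v w
    rw [← coe_curvatureMap hD]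
    rfl
  rw [h1, h2]
  exact curvature_tensorial hD X.2 (Subtype.prop _) Y.2 (Subtype.prop _) Z.2 (Subtype.prop _)
    (evalAt_extendLinear p _).symm (evalAt_extendLinear p _).symm (evalAt_extendLinear p _).symm

end CurvatureTensor

/-! ### Differentiating a parallel tensor of linear type -/

section ParallelVectorFields

open Topology Filter VectorField

variable {E : Type*} [NormedAddCommGroup E] [NormedSpace ℝ E]
  {M : Type*} [TopologicalSpace M] [ChartedSpace E M] [IsManifold 𝓘(ℝ, E) ∞ M]
  {g : PseudoRiemannianMetric E M} {D : Connection E M}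

/-- The metric at a point, as a bilinear map. -/
noncomputable def PseudoRiemannianMetric.form (g : PseudoRiemannianMetric E M) (p : M) :
    TangentSpace 𝓘(ℝ, E) p →ₗ[ℝ] TangentSpace 𝓘(ℝ, E) p →ₗ[ℝ] ℝ :=
  LinearMap.mk₂ ℝ (fun v w ↦ g.val p v w) (by simp) (by simp) (by simp) (by simp)

@[simp]
theorem PseudoRiemannianMetric.form_apply (g : PseudoRiemannianMetric E M) (p : M)
    (v w : TangentSpace 𝓘(ℝ, E) p) : g.form p v w = g.val p v w := rfl

/-- A vector field is parallel if all its covariant derivatives vanish. -/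
def ParallelField (D : Connection E M) (Y : VField E M) : Prop :=
  ∀ X : VField E M, SmoothField X → ∀ p, along D X Y p = 0

theorem along_form_smul (h : ParallelMetric D g) {X A B C : VField E M} (hX : SmoothField X)
    (hA : SmoothField A) (hB : SmoothField B) (hC : SmoothField C) (p : M) :
    along D X ((fun q ↦ g.val q (A q) (B q)) • C) p = g.val p (A p) (B p) • along D X C p +
      (g.val p (along D X A p) (B p) + g.val p (A p) (along D X B p)) • C p := by
  rw [along_funSMul D (g.contMDiff_apply hA hB) hC, h.mvfderiv_apply hX hA hB]

variable {J : ∀ p : M, TangentSpace 𝓘(ℝ, E) p →L[ℝ] TangentSpace 𝓘(ℝ, E) p}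
  {S : ∀ p : M, TangentSpace 𝓘(ℝ, E) p →L[ℝ]
    TangentSpace 𝓘(ℝ, E) p →L[ℝ] TangentSpace 𝓘(ℝ, E) p} {ε : ℝ} {ξ ζ : VField E M}

theorem along_sub_right (D : Connection E M) {X Y Z : VField E M}
    (hY : SmoothField Y) (hZ : SmoothField Z) :
    along D X (Y - Z) = along D X Y - along D X Z := by
  rw [sub_eq_add_neg, along_add_right D hY (ContMDiff.neg_section hZ), ← neg_one_smul ℝ Z,
    along_smul_right D _ hZ, neg_one_smul, sub_eq_add_neg]

/-- By the Leibniz rule, with `g` and `J` parallel, the derivative of `S` is the same formula with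
`ξ` and `ζ` replaced by their derivatives. -/
theorem linearTypeTensor_along_eq_zero (hsJ : SmoothEndo J) (hg : ParallelMetric D g)
    (hJ : ParallelEndo D J) (hS : ParallelTensor12 D S) (hξ : SmoothField ξ) (hζ : SmoothField ζ)
    (hlin : IsLinearType ε g J S ξ ζ) {X Y Z : VField E M} (hX : SmoothField X)
    (hY : SmoothField Y) (hZ : SmoothField Z) (p : M) :
    linearTypeTensor ε (g.form p) (J p : _ →ₗ[ℝ] _) (along D X ξ p) (along D X ζ p) (Y p) (Z p)
      = 0 := by
  have hJY := hsJ.smoothField hY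
  have hJZ := hsJ.smoothField hZ
  have hJξ := hsJ.smoothField hξ
  set f₁ : VField E M := (fun q ↦ g.val q (Y q) (Z q)) • ξ with hf₁
  set f₂ : VField E M := (fun q ↦ g.val q (ξ q) (Z q)) • Y with hf₂
  set f₃ : VField E M := (fun q ↦ g.val q (Y q) (J q (Z q))) • fun q ↦ J q (ξ q) with hf₃
  set f₄ : VField E M := (fun q ↦ g.val q (ξ q) (J q (Z q))) • fun q ↦ J q (Y q) with hf₄
  set f₅ : VField E M := (fun q ↦ g.val q (ζ q) (J q (Y q))) • fun q ↦ J q (Z q) with hf₅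
  have s₁ : SmoothField f₁ := hξ.smul (g.contMDiff_apply hY hZ)
  have s₂ : SmoothField f₂ := hY.smul (g.contMDiff_apply hξ hZ)
  have s₃ : SmoothField f₃ := hJξ.smul (g.contMDiff_apply hY hJZ)
  have s₄ : SmoothField f₄ := hJY.smul (g.contMDiff_apply hξ hJZ)
  have s₅ : SmoothField f₅ := hJZ.smul (g.contMDiff_apply hζ hJY)
  have hsm : ∀ (c : ℝ) {V : VField E M}, SmoothField V → SmoothField (c • V) :=
    fun c _ hV ↦ (smoothFields E M).smul_mem c hV
  have hsub : ∀ {V W : VField E M}, SmoothField V → SmoothField W → SmoothField (V - W) :=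
    fun hV hW ↦ (smoothFields E M).sub_mem hV hW
  have hadd : ∀ {V W : VField E M}, SmoothField V → SmoothField W → SmoothField (V + W) :=
    fun hV hW ↦ (smoothFields E M).add_mem hV hW
  have hT : (fun q ↦ S q (Y q) (Z q)) = f₁ - f₂ + ε • f₃ - ε • f₄ - (2 : ℝ) • f₅ := by
    funext q
    simp [hlin q, f₁, f₂, f₃, f₄, f₅, mul_smul]
  have key := hS X Y Z hX hY hZ p
  rw [hT, along_sub_right D (hsub (hadd (hsub s₁ s₂) (hsm _ s₃)) (hsm _ s₄)) (hsm _ s₅),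
    along_sub_right D (hadd (hsub s₁ s₂) (hsm _ s₃)) (hsm _ s₄),
    along_add_right D (hsub s₁ s₂) (hsm _ s₃), along_sub_right D s₁ s₂,
    along_smul_right D _ s₃, along_smul_right D _ s₄, along_smul_right D _ s₅] at key
  simp only [Pi.sub_apply, Pi.add_apply, Pi.smul_apply] at key
  rw [along_form_smul hg hX hY hZ hξ, along_form_smul hg hX hξ hZ hY,
    along_form_smul hg hX hY hJZ hJξ, along_form_smul hg hX hξ hJZ hJY,
    along_form_smul hg hX hζ hJY hJZ, hJ X ξ hX hξ, hJ X Y hX hY, hJ X Z hX hZ,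
    hlin, hlin] at key
  rw [← sub_eq_zero] at key
  rw [← key]
  simp only [linearTypeTensor, PseudoRiemannianMetric.form_apply, ContinuousLinearMap.coe_coe]
  module

end ParallelVectorFields

/-! ### From the manifold to the algebraic model at a point -/

section InfinitesimalModel

open Topology Filter VectorField

variable {E : Type*} [NormedAddCommGroup E] [NormedSpace ℝ E] [FiniteDimensional ℝ E]
  {M : Type*} [TopologicalSpace M] [ChartedSpace E M] [IsManifold 𝓘(ℝ, E) ∞ M]
  {g : PseudoRiemannianMetric E M} {D : Connection E M}
  {J : ∀ p : M, TangentSpace 𝓘(ℝ, E) p →L[ℝ] TangentSpace 𝓘(ℝ, E) p}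
  {S : ∀ p : M, TangentSpace 𝓘(ℝ, E) p →L[ℝ]
    TangentSpace 𝓘(ℝ, E) p →L[ℝ] TangentSpace 𝓘(ℝ, E) p} {ε : ℝ} {ξ ζ : VField E M}

instance (p : M) : FiniteDimensional ℝ (TangentSpace 𝓘(ℝ, E) p) :=
  inferInstanceAs (FiniteDimensional ℝ E)

omit [FiniteDimensional ℝ E] in
theorem IsEpsKahler.isHermitianForm (hε : ε = 1 ∨ ε = -1) (hJ : IsEpsKahler ε g D J) (p : M) :
    IsHermitianForm ε (g.form p) (J p : _ →ₗ[ℝ] _) where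
  eps := hε
  symm := g.symm p
  nondegenerate := g.nondegenerate p
  skew x y := eq_neg_of_add_eq_zero_left (hJ.skew p x y)
  sq := hJ.sq p

theorem parallelField_subTensor [T2Space M] (hn : 4 ≤ finrank ℝ E) (hε : ε = 1 ∨ ε = -1)
    (hJ : IsEpsKahler ε g D J) (hS : IsHomogeneousStructure g D J S) (hξ : SmoothField ξ)
    (hζ : SmoothField ζ) (hlin : IsLinearType ε g J S ξ ζ) :
    ParallelField (subTensor D S) ξ ∧ ParallelField (subTensor D S) ζ := by
  have key : ∀ X : VField E M, SmoothField X → ∀ p, along (subTensor D S) X ξ p = 0 ∧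
      along (subTensor D S) X ζ p = 0 := by
    intro X hX p
    refine IsHermitianForm.eq_zero_of_linearTypeTensor_eq_zero (by exact hn)
      (hJ.isHermitianForm hε p) fun x y ↦ ?_
    have := linearTypeTensor_along_eq_zero hJ.smooth hS.parallel_metric hS.parallel_endo
      hS.parallel_self hξ hζ hlin hX (smoothField_globalExtend p x)
      (smoothField_globalExtend p y) p
    rwa [globalExtend_apply_self, globalExtend_apply_self] at this
  exact ⟨fun X hX p ↦ (key X hX p).1, fun X hX p ↦ (key X hX p).2⟩

/-- A smooth tensor field of type `(1, 2)`, as a bilinear operation on smooth vector fields. -/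
noncomputable def tensorMap (hS : SmoothTensor12 S) :
    smoothFields E M →ₗ[ℝ] smoothFields E M →ₗ[ℝ] smoothFields E M :=
  LinearMap.mk₂ ℝ (fun X Y ↦ ⟨fun q ↦ S q ((X : VField E M) q) ((Y : VField E M) q),
      hS.smoothField X.2 Y.2⟩)
    (fun _ _ _ ↦ by apply Subtype.ext; funext p; simp)
    (fun _ _ _ ↦ by apply Subtype.ext; funext p; simp)
    (fun _ _ _ ↦ by apply Subtype.ext; funext p; simp)
    (fun _ _ _ ↦ by apply Subtype.ext; funext p; simp)

variable [T2Space M] [Nontrivial E]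

theorem curvatureTensor_comm (hD : IsLeviCivita g D) (hJ : IsEpsKahler ε g D J) (p : M)
    (x y w : TangentSpace 𝓘(ℝ, E) p) :
    curvatureTensor hD p x y (J p w) = J p (curvatureTensor hD p x y w) := by
  let JV : smoothFields E M → smoothFields E M :=
    fun V ↦ ⟨fun q ↦ J q ((V : VField E M) q), hJ.smooth.smoothField V.2⟩
  have hN : ∀ U V : smoothFields E M, connMap hD.smoothConnection U (JV V) =
      JV (connMap hD.smoothConnection U V) := by
    intro U V
    apply Subtype.ext
    funext q
    exact hJ.parallel U V U.2 V.2 q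
  have hsub : ∀ U V : smoothFields E M, JV (U - V) = JV U - JV V := by
    intro U V
    apply Subtype.ext
    funext q
    exact map_sub (J q) _ _
  have h := evalAt_curvatureMap hD p (extendLinear E p x) (extendLinear E p y)
    (JV (extendLinear E p w))
  have h2 : evalAt p (JV (extendLinear E p w)) = J p w :=
    congr_arg (J p) (evalAt_extendLinear p w)
  rw [h2, evalAt_extendLinear, evalAt_extendLinear, curvatureMap_apply] at h
  have h3 : ∀ V, evalAt p (JV V) = J p (evalAt p V) := fun V ↦ rfl
  rw [← h]
  simp only [← hsub, hN, h3]
  rfl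

/-- Each identity is proved formally for operators on smooth fields and then evaluated at `p`; every
tangent vector is the value of a global smooth field. -/
theorem isInfinitesimalModel (hn : 4 ≤ finrank ℝ E) (hε : ε = 1 ∨ ε = -1)
    (hD : IsLeviCivita g D) (hJ : IsEpsKahler ε g D J) (hS : IsHomogeneousStructure g D J S)
    (hξ : SmoothField ξ) (hζ : SmoothField ζ) (hlin : IsLinearType ε g J S ξ ζ) (p : M)
    (hnull : g.val p (ξ p) (ξ p) = 0) (hne : ξ p ≠ 0) :
    IsInfinitesimalModel ε (g.form p) (J p : _ →ₗ[ℝ] _) (ξ p) (ζ p) (curvatureTensor hD p) := by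
  obtain ⟨pξ, pζ⟩ := parallelField_subTensor hn hε hJ hS hξ hζ hlin
  have sD := hD.smoothConnection
  have sD' := sD.subTensor hS.smooth
  set N := connMap sD with hNdef
  set N' := connMap sD' with hN'def
  set T := tensorMap hS.smooth with hTdef
  set R := curvatureMap N with hRdef
  have hNT : ∀ X Y, N X Y = N' X Y + T X Y := by
    intro X Y
    apply Subtype.ext
    funext q
    have := along_subTensor D S X Y q
    exact (eq_add_of_sub_eq this.symm)
  have hT : ∀ X Y Z, N' X (T Y Z) = T (N' X Y) Z + T Y (N' X Z) := fun X Y Z ↦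
    Subtype.ext (funext (hS.parallel_self X Y Z X.2 Y.2 Z.2))
  have hR : ∀ X Y Z W, N' X (R Y Z W) = R (N' X Y) Z W + R Y (N' X Z) W + R Y Z (N' X W) := by
    intro X Y Z W
    apply Subtype.ext
    have := funext (hS.parallel_curvature X Y Z W X.2 Y.2 Z.2 W.2)
    rw [← coe_curvatureMap hD, ← coe_connMap sD' X Y, ← coe_connMap sD' X Z, ← coe_connMap sD' X W]
      at this
    simp only [← coe_curvatureMap hD] at this
    exact this
  have evT : ∀ X Y, evalAt p (T X Y) = linearTypeTensor ε (g.form p) (J p : _ →ₗ[ℝ] _) (ξ p) (ζ p)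
      (evalAt p X) (evalAt p Y) := fun X Y ↦ hlin p _ _
  have evR : ∀ X Y Z, evalAt p (R X Y Z) =
      curvatureTensor hD p (evalAt p X) (evalAt p Y) (evalAt p Z) := evalAt_curvatureMap hD p
  have evQ : ∀ X Y Z, evalAt p (relCurvature N N' X Y Z) =
      curvatureTensor hD p (evalAt p X) (evalAt p Y) (evalAt p Z) -
      reductionCurvature ε (g.form p) (J p : _ →ₗ[ℝ] _) (ξ p) (ζ p)
        (evalAt p X) (evalAt p Y) (evalAt p Z) := by
    intro X Y Z
    rw [← evR, hRdef, curvatureMap_eq_relCurvature_add hNT hT]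
    simp only [map_add, map_sub (evalAt p), evT, reductionCurvature, add_sub_cancel_right]
  have ev : ∀ v : TangentSpace 𝓘(ℝ, E) p, ∃ X : smoothFields E M, evalAt p X = v :=
    fun v ↦ ⟨_, evalAt_extendLinear p v⟩
  -- The curvature of `D - S` annihilates a parallel field, and by `evQ` it equals `R` minus the
  -- reduction term.
  have par : ∀ {η : VField E M} (hη : SmoothField η), ParallelField (subTensor D S) η → ∀ x y,
      curvatureTensor hD p x y (η p) =
        reductionCurvature ε (g.form p) (J p : _ →ₗ[ℝ] _) (ξ p) (ζ p) x y (η p) := by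
    intro η hη pη x y
    obtain ⟨X, rfl⟩ := ev x
    obtain ⟨Y, rfl⟩ := ev y
    have h0 : ∀ U : smoothFields E M, N' U ⟨η, hη⟩ = 0 := fun U ↦
      Subtype.ext (funext (pη U U.2))
    have h1 := evQ X Y ⟨η, hη⟩
    rw [relCurvature_apply, h0, h0, h0] at h1
    simp only [map_zero, sub_zero] at h1
    exact sub_eq_zero.1 h1.symm
  refine { hJ.isHermitianForm hε p with
    null := hnull
    ne_zero := hne
    swap := ?_
    bianchi := ?_
    metric := ?_
    comm := curvatureTensor_comm hD hJ p
    bianchi_action := ?_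
    apply_xi := par hξ pξ
    apply_zeta := par hζ pζ
    derivation := ?_ }
  · intro x y w
    obtain ⟨X, rfl⟩ := ev x
    obtain ⟨Y, rfl⟩ := ev y
    obtain ⟨W, rfl⟩ := ev w
    rw [← evR, hRdef, curvatureMap_swap, map_neg, evR]
  · intro x y w
    obtain ⟨X, rfl⟩ := ev x
    obtain ⟨Y, rfl⟩ := ev y
    obtain ⟨W, rfl⟩ := ev w
    rw [← evR, ← evR, ← evR, ← map_add, ← map_add, hRdef,
      curvatureMap_bianchi (satisfiesJacobi_connMap hD), map_zero]
  · intro x y w u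
    obtain ⟨X, rfl⟩ := ev x
    obtain ⟨Y, rfl⟩ := ev y
    obtain ⟨W, rfl⟩ := ev w
    obtain ⟨U, rfl⟩ := ev u
    have h := curvature_metric hD.metric sD X.2 Y.2 W.2 U.2 p
    rw [← coe_curvatureMap hD, ← coe_curvatureMap hD, g.symm p ((W : VField E M) p)] at h
    rw [← evR, ← evR]
    exact h
  · intro x y z w
    obtain ⟨X, rfl⟩ := ev x
    obtain ⟨Y, rfl⟩ := ev y
    obtain ⟨Z, rfl⟩ := ev z
    obtain ⟨W, rfl⟩ := ev w
    have h := curvatureMap_bianchi_deriv (satisfiesJacobi_connMap hD) X Y Z W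
    -- With `N = N' + T` and `R` parallel for `N'`, the covariant derivative of `R` is the action of
    -- `T`.
    have step : ∀ X Y Z W, N X (R Y Z W) - R (N X Y) Z W - R Y (N X Z) W - R Y Z (N X W) =
        T X (R Y Z W) - R (T X Y) Z W - R Y (T X Z) W - R Y Z (T X W) := by
      intro X Y Z W
      simp only [hNT, hR, map_add, LinearMap.add_apply]
      abel
    rw [step, step, step] at h
    have h' := congr_arg (evalAt p) h
    simpa only [map_add, map_sub, map_zero, evT, evR, curvatureAction] using h'
  · intro x y a b c
    obtain ⟨X, rfl⟩ := ev x
    obtain ⟨Y, rfl⟩ := ev y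
    obtain ⟨A, rfl⟩ := ev a
    obtain ⟨B, rfl⟩ := ev b
    obtain ⟨C, rfl⟩ := ev c
    have h := congr_arg (evalAt p) (relCurvature_apply_of_parallel (N := N) hR X Y A B C)
    simpa only [map_add, evQ, evR] using h

end InfinitesimalModel

/-! ### Parallel fields with a zero vanish: linear differential equations and connectedness -/

section LinearSystems

/-- A solution of a linear system of ordinary differential equations with bounded coefficients that
vanishes at the initial point vanishes. -/
theorem eq_zero_of_hasDerivAt_linear {ι : Type*} [Fintype ι] {y : ℝ → ι → ℝ}
    {A : ℝ → ι → ι → ℝ} {C : ℝ}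
    (hy : ∀ t ∈ Set.Icc (0 : ℝ) 1, ∀ j, HasDerivAt (fun s ↦ y s j) (∑ i, A t i j * y t i) t)
    (hA : ∀ t ∈ Set.Icc (0 : ℝ) 1, ∀ i j, |A t i j| ≤ C) (h0 : y 0 = 0) : y 1 = 0 := by
  have hd : ∀ t ∈ Set.Icc (0 : ℝ) 1, HasDerivAt y (fun j ↦ ∑ i, A t i j * y t i) t :=
    fun t ht ↦ hasDerivAt_pi.2 (hy t ht)
  refine eq_zero_of_abs_deriv_le_mul_abs_self_of_eq_zero_right (K := Fintype.card ι * C)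
    (fun t ht ↦ (hd t ht).continuousAt.continuousWithinAt)
    (fun t ht ↦ (hd t (Set.Ico_subset_Icc_self ht)).hasDerivWithinAt) h0 ?_ 1 (by simp)
  intro t ht
  have ht' := Set.Ico_subset_Icc_self ht
  rcases isEmpty_or_nonempty ι with hι | ⟨⟨i₀⟩⟩
  · simp [Subsingleton.elim (y t) 0]
    rfl
  have hC : 0 ≤ C := (abs_nonneg _).trans (hA t ht' i₀ i₀)
  refine (pi_norm_le_iff_of_nonneg (by positivity)).2 fun j ↦ ?_
  calc ‖∑ i, A t i j * y t i‖ ≤ ∑ i, ‖A t i j * y t i‖ := norm_sum_le _ _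
    _ ≤ ∑ _i : ι, C * ‖y t‖ := by
      refine Finset.sum_le_sum fun i _ ↦ ?_
      rw [norm_mul]
      exact mul_le_mul (hA t ht' i j) (norm_le_pi_norm _ i) (norm_nonneg _) hC
    _ = Fintype.card ι * C * ‖y t‖ := by simp [mul_assoc]

end LinearSystems

section ParallelVanishing

open Topology Filter VectorField

variable {E : Type*} [NormedAddCommGroup E] [NormedSpace ℝ E]
  {M : Type*} [TopologicalSpace M] [ChartedSpace E M] [IsManifold 𝓘(ℝ, E) ∞ M]
  {g : PseudoRiemannianMetric E M} {D : Connection E M} {η : VField E M}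

/-- The derivative of a function along a straight line in a chart. -/
theorem hasDerivAt_comp_extChartAt_symm {f : M → ℝ} (hf : ContMDiff 𝓘(ℝ, E) 𝓘(ℝ, ℝ) ∞ f)
    (p : M) (x v : E) (t : ℝ) (ht : x + t • v ∈ (extChartAt 𝓘(ℝ, E) p).target) :
    HasDerivAt (fun s : ℝ ↦ f ((extChartAt 𝓘(ℝ, E) p).symm (x + s • v)))
      (mvfderiv 𝓘(ℝ, E) f ((extChartAt 𝓘(ℝ, E) p).symm (x + t • v))
        ((trivializationAt E (TangentSpace 𝓘(ℝ, E)) p).symmL ℝ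
          ((extChartAt 𝓘(ℝ, E) p).symm (x + t • v)) v)) t := by
  set φ := extChartAt 𝓘(ℝ, E) p
  set q := φ.symm (x + t • v)
  have hq : q ∈ (chartAt E p).source := by
    rw [← extChartAt_source 𝓘(ℝ, E)]
    exact φ.map_target ht
  have hφ : φ q = x + t • v := φ.right_inv ht
  have h1 : HasMFDerivAt 𝓘(ℝ, E) 𝓘(ℝ, ℝ) f q (mfderiv 𝓘(ℝ, E) 𝓘(ℝ, ℝ) f q) :=
    (hf.mdifferentiable (by simp) q).hasMFDerivAt
  have h2 : HasMFDerivAt 𝓘(ℝ, E) 𝓘(ℝ, E) φ.symm (x + t • v)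
      (mfderiv 𝓘(ℝ, E) 𝓘(ℝ, E) φ.symm (x + t • v)) := by
    have := ((contMDiffOn_extChartAt_symm (I := 𝓘(ℝ, E)) (n := ∞) p).contMDiffAt
      ((isOpen_extChartAt_target p).mem_nhds ht)).mdifferentiableAt (by simp)
    exact this.hasMFDerivAt
  have h3 := HasMFDerivAt.comp (x + t • v) h1 h2
  have h4 : HasDerivAt (fun s : ℝ ↦ x + s • v) v t := by
    simpa using ((hasDerivAt_id t).smul_const v).const_add x
  have h5 := (hasMFDerivAt_iff_hasFDerivAt.1 h3).comp_hasDerivAt t h4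
  have h6 := TangentBundle.symmL_trivializationAt (I := 𝓘(ℝ, E)) hq
  rw [h6, hφ]
  simp only [modelWithCornersSelf_coe, Set.range_id, mfderivWithin_univ]
  exact h5

variable [FiniteDimensional ℝ E]

omit [FiniteDimensional ℝ E] in
/-- Expansion of a tangent vector near `p` in a frame with constant coordinates at `p`. -/
theorem eq_sum_symmL {ι : Type*} [Fintype ι] (w : Basis ι ℝ E) {p q : M}
    (hq : q ∈ (chartAt E p).source) (u : TangentSpace 𝓘(ℝ, E) q) :
    u = ∑ i, w.repr (trivializationAt E (TangentSpace 𝓘(ℝ, E)) p ⟨q, u⟩).2 i •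
      (trivializationAt E (TangentSpace 𝓘(ℝ, E)) p).symmL ℝ q (w i) := by
  set t := trivializationAt E (TangentSpace 𝓘(ℝ, E) : M → Type _) p
  have hq' : q ∈ t.baseSet := hq
  have h1 : t.symmL ℝ q (t ⟨q, u⟩).2 = u := by
    have := t.symmL_continuousLinearMapAt (R := ℝ) hq' u
    rwa [t.continuousLinearMapAt_apply_of_mem ℝ hq'] at this
  conv_lhs => rw [← h1, ← w.sum_repr (t ⟨q, u⟩).2, map_sum]
  simp only [map_smul]
  rfl

variable [T2Space M]

/-- For a local frame `F j`, `D g = 0` and `D η = 0` give `F_k g(η, F_j) = g(η, D_{F_k} F_j)`, a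
combination of the `g(η, F_i)`. Along chart segments from `p` these functions solve a linear system
with zero initial value. -/
theorem eventually_eq_zero_of_parallelField (hg : ParallelMetric D g) (hD : SmoothConnection D)
    (hη : SmoothField η) (hpar : ParallelField D η) {p : M} (h0 : η p = 0) :
    ∀ᶠ q in 𝓝 p, η q = 0 := by
  set t := trivializationAt E (TangentSpace 𝓘(ℝ, E) : M → Type _) p with ht
  set w := finBasis ℝ E
  set φ := extChartAt 𝓘(ℝ, E) p with hφ
  have hpt : p ∈ t.baseSet := mem_chart_source E p
  set F : Fin (finrank ℝ E) → VField E M := fun j ↦ globalExtend p (t.symmL ℝ p (w j)) with hF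
  have hFs : ∀ j, SmoothField (F j) := fun j ↦ smoothField_globalExtend p _
  set Γ : M → Fin (finrank ℝ E) → Fin (finrank ℝ E) → Fin (finrank ℝ E) → ℝ :=
    fun q k j i ↦ w.repr (t ⟨q, along D (F k) (F j) q⟩).2 i with hΓ
  have hΓc : ContinuousAt Γ p := by
    refine continuousAt_pi.2 fun k ↦ continuousAt_pi.2 fun j ↦ continuousAt_pi.2 fun i ↦ ?_
    have h1 := ((contMDiffAt_section p).1 (hD (F k) (F j) (hFs k) (hFs j) p)).continuousAt
    have h2 : Continuous (w.coord i) := LinearMap.continuous_of_finiteDimensional _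
    exact h2.continuousAt.comp h1
  set f : Fin (finrank ℝ E) → M → ℝ := fun j q ↦ g.val q (η q) (F j q) with hf
  have hfs : ∀ j, ContMDiff 𝓘(ℝ, E) 𝓘(ℝ, ℝ) ∞ (f j) := fun j ↦ g.contMDiff_apply hη (hFs j)
  -- Any bound above `‖Γ p‖` holds near `p` by continuity, which keeps the system's coefficients
  -- bounded.
  set G := ‖Γ p‖ + 1
  have hgood : ∀ᶠ q in 𝓝 p, (∀ j, F j q = t.symmL ℝ q (w j)) ∧ ‖Γ q‖ < G := by
    have h1 := hΓc.norm.eventually_lt continuousAt_const (lt_add_one ‖Γ p‖)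
    have h2 : ∀ j, ∀ᶠ q in 𝓝 p, F j q = t.symmL ℝ q (w j) := by
      intro j
      filter_upwards [globalExtend_eventuallyEq p (t.symmL ℝ p (w j)),
        t.open_baseSet.mem_nhds hpt] with q hq hq'
      refine hq.trans ((extendAt_apply hq' _).symm.trans ?_)
      exact congr_arg (t.symmₗ ℝ q) (t.linearMapAt_symmₗ (R := ℝ) hpt (w j))
    filter_upwards [eventually_all.2 h2, h1] with q hq hq' using ⟨hq, hq'⟩
  have hgood' : ∀ᶠ x in 𝓝 (φ p), x ∈ φ.target ∧
      (∀ j, F j (φ.symm x) = t.symmL ℝ (φ.symm x) (w j)) ∧ ‖Γ (φ.symm x)‖ < G := by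
    have hc : Tendsto φ.symm (𝓝 (φ p)) (𝓝 p) := by
      have := (continuousAt_extChartAt_symm (I := 𝓘(ℝ, E)) p).tendsto
      rwa [extChartAt_to_inv] at this
    exact Filter.Eventually.and (extChartAt_target_mem_nhds p) (hc.eventually hgood)
  obtain ⟨r, hr, hball⟩ := Metric.eventually_nhds_iff_ball.1 hgood'
  have hnear : ∀ᶠ q in 𝓝 p, φ q ∈ Metric.ball (φ p) r :=
    (continuousAt_extChartAt p).eventually (Metric.ball_mem_nhds _ hr)
  filter_upwards [hnear, extChartAt_source_mem_nhds (I := 𝓘(ℝ, E)) p] with q hqr hqs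
  set v := φ q - φ p
  have hline : ∀ s ∈ Set.Icc (0 : ℝ) 1, φ p + s • v ∈ Metric.ball (φ p) r := by
    intro s hs
    rw [Metric.mem_ball, dist_eq_norm] at hqr ⊢
    rw [add_sub_cancel_left, norm_smul, Real.norm_of_nonneg hs.1]
    exact (mul_le_of_le_one_left (norm_nonneg _) hs.2).trans_lt hqr
  have key := eq_zero_of_hasDerivAt_linear
    (y := fun s j ↦ f j (φ.symm (φ p + s • v)))
    (A := fun s i j ↦ ∑ k, w.repr v k * Γ (φ.symm (φ p + s • v)) k j i)
    (C := ∑ k, |w.repr v k| * G) ?_ ?_ ?_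
  · have hq1 : φ.symm (φ p + (1 : ℝ) • v) = q := by
      rw [one_smul, add_sub_cancel]
      exact φ.left_inv hqs
    have hfq : ∀ j, f j q = 0 := fun j ↦
      (congr_arg (f j) hq1).symm.trans (congr_fun key j)
    have hqs' : q ∈ (chartAt E p).source := by rwa [← extChartAt_source 𝓘(ℝ, E)]
    have hFq : ∀ j, F j q = t.symmL ℝ q (w j) := by
      have := (hball _ (hline 1 (by simp))).2.1
      rwa [hq1] at this
    refine g.nondegenerate q _ fun u ↦ ?_
    rw [eq_sum_symmL w hqs' u, map_sum]
    refine Finset.sum_eq_zero fun i _ ↦ ?_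
    rw [map_smul]
    exact smul_eq_zero_of_right _ ((congr_arg (g.val q (η q)) (hFq i)).symm.trans (hfq i))
  · intro s hs j
    obtain ⟨hxt, hFx, -⟩ := hball _ (hline s hs)
    have hd := hasDerivAt_comp_extChartAt_symm (hfs j) p (φ p) v s hxt
    convert hd using 1
    set x := φ.symm (φ p + s • v)
    have hx : x ∈ (chartAt E p).source := by
      rw [← extChartAt_source 𝓘(ℝ, E)]
      exact φ.map_target hxt
    have hv : t.symmL ℝ x v = ∑ k, w.repr v k • F k x := by
      conv_lhs => rw [← w.sum_repr v, map_sum]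
      simp only [map_smul, hFx]
    have hk : ∀ k, mvfderiv 𝓘(ℝ, E) (f j) x (F k x) = ∑ i, Γ x k j i * f i x := by
      intro k
      rw [hg.mvfderiv_apply (hFs k) hη (hFs j), hpar _ (hFs k), map_zero]
      simp only [zero_apply, zero_add]
      conv_lhs => rw [eq_sum_symmL w hx (along D (F k) (F j) x), map_sum]
      refine Finset.sum_congr rfl fun i _ ↦ ?_
      rw [map_smul]
      exact congr_arg (fun z ↦ Γ x k j i * g.val x (η x) z) (hFx i).symm
    change _ = mvfderiv 𝓘(ℝ, E) (f j) x (t.symmL ℝ x v)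
    rw [hv, map_sum]
    simp only [map_smul, hk, Finset.sum_mul, smul_eq_mul, Finset.mul_sum]
    rw [Finset.sum_comm]
    simp only [mul_assoc]
  · intro s hs i j
    obtain ⟨-, -, hG⟩ := hball _ (hline s hs)
    refine (Finset.abs_sum_le_sum_abs _ _).trans (Finset.sum_le_sum fun k _ ↦ ?_)
    rw [abs_mul]
    refine mul_le_mul_of_nonneg_left ?_ (abs_nonneg _)
    refine le_trans ?_ hG.le
    exact (norm_le_pi_norm (Γ (φ.symm (φ p + s • v)) k j) i).trans
      ((norm_le_pi_norm (Γ (φ.symm (φ p + s • v)) k) j).trans (norm_le_pi_norm _ k))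
  · funext j
    have : φ.symm (φ p + (0 : ℝ) • v) = p := by
      rw [zero_smul, add_zero]
      exact extChartAt_to_inv p
    simp only [this, hf, h0, map_zero]
    rfl

/-- The zero set is closed by continuity and nondegeneracy of `g`, and open by the local statement.
-/
theorem eq_zero_of_parallelField [ConnectedSpace M] (hg : ParallelMetric D g)
    (hD : SmoothConnection D) (hη : SmoothField η) (hpar : ParallelField D η) {p : M}
    (h0 : η p = 0) : η = 0 := by
  have hclopen : IsClopen {q | η q = 0} := by
    constructor
    · rw [← isOpen_compl_iff, isOpen_iff_mem_nhds]
      intro q hq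
      obtain ⟨u, hu⟩ : ∃ u, g.val q (η q) u ≠ 0 := by
        by_contra! h
        exact hq (g.nondegenerate q _ h)
      have hc := (g.contMDiff_apply hη (smoothField_globalExtend q u)).continuous.continuousAt
        (x := q)
      have := hc.eventually_ne (y := 0) (by rwa [globalExtend_apply_self])
      filter_upwards [this] with q' hq' hz
      have hz' : η q' = 0 := hz
      rw [hz', map_zero] at hq'
      exact hq' rfl
    · exact isOpen_iff_mem_nhds.2 fun q hq ↦ eventually_eq_zero_of_parallelField hg hD hη hpar hq
  funext q
  have hq : q ∈ {q | η q = 0} := hclopen.eq_univ ⟨p, h0⟩ ▸ Set.mem_univ q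
  exact hq

end ParallelVanishing

/-! ### Assembling the result -/

section Conclusion

variable {E : Type*} [NormedAddCommGroup E] [NormedSpace ℝ E] [FiniteDimensional ℝ E]
  {M : Type*} [TopologicalSpace M] [ChartedSpace E M] [IsManifold 𝓘(ℝ, E) ∞ M]
  {g : PseudoRiemannianMetric E M} {D : Connection E M}

theorem ricci_eq_ricciForm [T2Space M] (hD : IsLeviCivita g D) (p : M)
    (v w : TangentSpace 𝓘(ℝ, E) p) : ricci D p v w = ricciForm (curvatureTensor hD p) v w := by
  simp only [ricci, curvatureAt_eq_curvatureTensor hD]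
  exact sum_repr_eq_trace (tangentBasis p) ((curvatureTensor hD p v).flip w)

omit [FiniteDimensional ℝ E] in
theorem ParallelField.sub_smul {ξ ζ : VField E M} (hξ : SmoothField ξ) (hζ : SmoothField ζ)
    (pξ : ParallelField D ξ) (pζ : ParallelField D ζ) (c : ℝ) : ParallelField D (ζ - c • ξ) := by
  intro X hX p
  rw [along_sub_right D hζ ((smoothFields E M).smul_mem c hξ), along_smul_right D c hξ]
  simp [pξ X hX p, pζ X hX p]

end Conclusion

end EpsKahler

theorem proposition3p2
    {E : Type*} [NormedAddCommGroup E] [NormedSpace ℝ E] [FiniteDimensional ℝ E]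
    {M : Type*} [TopologicalSpace M] [ChartedSpace E M] [IsManifold 𝓘(ℝ, E) ∞ M]
    [T2Space M] [ConnectedSpace M]
    (hdim : 4 ≤ finrank ℝ E)
    (ε : ℝ) (hε : ε = 1 ∨ ε = -1)
    (g : PseudoRiemannianMetric E M)
    (D : Connection E M) (hD : IsLeviCivita g D)
    (J : ∀ p : M, TangentSpace 𝓘(ℝ, E) p →L[ℝ] TangentSpace 𝓘(ℝ, E) p)
    (hJ : IsEpsKahler ε g D J)
    (S : ∀ p : M, TangentSpace 𝓘(ℝ, E) p →L[ℝ]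
      TangentSpace 𝓘(ℝ, E) p →L[ℝ] TangentSpace 𝓘(ℝ, E) p)
    (hS : IsHomogeneousStructure g D J S)
    (ξ ζ : VField E M) (hξ : SmoothField ξ) (hζ : SmoothField ζ)
    (hlin : IsLinearType ε g J S ξ ζ) (hdeg : IsDegenerate g ξ)
    (a : ℝ) (ha : a = 1 / ((finrank ℝ E : ℝ) + 2))
    (θ : ∀ p : M, TangentSpace 𝓘(ℝ, E) p →L[ℝ] ℝ) (hθ : ∀ p, θ p = g.val p (ξ p)) :
    ∃ lam : ℝ,
      (∀ p, ζ p = lam • ξ p) ∧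
      (∀ (p : M) (v w : TangentSpace 𝓘(ℝ, E) p),
        ricci D p v w =
          -(1 / a) * lam * (ε + 2 * lam) *
            (θ p v * θ p w - ε * (θ p (J p v) * θ p (J p w)))) ∧
      (∀ p, scalarCurvature g D p = 0) := by
  have : Nontrivial E := Module.nontrivial_of_finrank_pos (R := ℝ) (by omega)
  obtain ⟨pξ, pζ⟩ := parallelField_subTensor hdim hε hJ hS hξ hζ hlin
  have sD' := hD.smoothConnection.subTensor hS.smooth
  have hne : ∀ p, ξ p ≠ 0 := fun p h0 ↦
    hdeg.1 (eq_zero_of_parallelField hS.parallel_metric sD' hξ pξ h0)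
  have model := fun p ↦ isInfinitesimalModel hdim hε hD hJ hS hξ hζ hlin p (hdeg.2 p) (hne p)
  have pointwise := fun p ↦ (model p).exists_eq_smul_and_ricci_eq (by exact hdim)
  obtain ⟨p₀⟩ : Nonempty M := inferInstance
  obtain ⟨lam, hlam, -⟩ := pointwise p₀
  -- `ζ - lam • ξ` is parallel and vanishes at `p₀`. The constant found at any other point equals
  -- `lam` because `ξ` has no zeros.
  have hζξ : ∀ p, ζ p = lam • ξ p := by
    have h0 : ζ - lam • ξ = 0 := eq_zero_of_parallelField hS.parallel_metric sD'
      ((smoothFields E M).sub_mem hζ ((smoothFields E M).smul_mem lam hξ))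
      (ParallelField.sub_smul hξ hζ pξ pζ lam) (p := p₀) (by simp [hlam])
    exact fun p ↦ congr_fun (sub_eq_zero.1 h0) p
  have hricci : ∀ (p : M) (v w : TangentSpace 𝓘(ℝ, E) p), ricci D p v w =
      -(1 / a) * lam * (ε + 2 * lam) *
        (θ p v * θ p w - ε * (θ p (J p v) * θ p (J p w))) := by
    intro p v w
    obtain ⟨c, hc, hr⟩ := pointwise p
    have hcl : c = lam := smul_left_injective ℝ (hne p) (hc.symm.trans (hζξ p))
    rw [ricci_eq_ricciForm hD, hr, hcl, ha, hθ, one_div_one_div]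
    rfl
  refine ⟨lam, hζξ, hricci, fun p ↦ ?_⟩
  have hH := hJ.isHermitianForm hε p
  have h1 := hH.sum_gram_inv_mul (tangentBasis p) (gramMatrix g p) (fun _ _ ↦ rfl) (ξ p)
  have h2 := hH.sum_gram_inv_mul (tangentBasis p) (gramMatrix g p) (fun _ _ ↦ rfl) (J p (ξ p))
  have hJJ : g.val p (J p (ξ p)) (J p (ξ p)) = 0 := by
    have := hH.form_J_J (ξ p) (ξ p)
    simpa [hdeg.2 p] using this
  have hθJ : ∀ v, g.val p (ξ p) (J p v) = -g.val p (J p (ξ p)) v := fun v ↦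
    eq_neg_of_add_eq_zero_right (hJ.skew p (ξ p) v)
  simp only [PseudoRiemannianMetric.form_apply, hdeg.2 p, hJJ] at h1 h2
  -- As `θ ∘ J = -g(Jξ, ·)`, the trace is a multiple of `g(ξ, ξ) - ε g(Jξ, Jξ)`, and both vectors
  -- are null.
  have : scalarCurvature g D p = -(1 / a) * lam * (ε + 2 * lam) *
      (∑ i, ∑ j, (gramMatrix g p)⁻¹ i j *
          (g.val p (ξ p) (tangentBasis p i) * g.val p (ξ p) (tangentBasis p j)) -
        ε * ∑ i, ∑ j, (gramMatrix g p)⁻¹ i j *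
          (g.val p (J p (ξ p)) (tangentBasis p i) * g.val p (J p (ξ p)) (tangentBasis p j))) := by
    simp only [scalarCurvature, hricci, hθ, hθJ, Finset.mul_sum, mul_sub,
      ← Finset.sum_sub_distrib]
    refine Finset.sum_congr rfl fun i _ ↦ Finset.sum_congr rfl fun j _ ↦ ?_
    ring
  rw [this]
  rw [h1, h2, mul_zero, sub_zero, mul_zero]
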